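/- Let $q=2^n\equiv 1\pmod 3$ and let $\omega$ be a primitive element of $\mathbb F_q$. In $\mathrm{PG}(5,q)$ with homogeneous coordinates $(X_1,\dots,X_6)$, let $U_i$ be the point with $1$ in position $i$ and $0$ elsewhere, let $\Pi$ be the hyperplane $X_3+X_4=0$, let $\mathcal Q(4,q)$ be the parabolic quadric cut out on $\Pi$ by the Klein quadric $X_1X_6+X_2X_5+X_3X_4=0$, and let $\mathcal Y$ be the set of points of $\Pi$ satisfying $X_1X_5^2+X_2^2X_6=0$. Let $\tilde G_1$ be the group of projectivities of $\mathrm{PG}(5,q)$ represented (acting on column vectors) by the matrices $$\begin{pmatrix} a^4&0&a^2b^2&a^2b^2&0&b^4\\ 0&a^2&ab&ab&b^2&0\\ a^2c^2&ac&b^2c^2+bc+1&b^2c^2+bc&bd&b^2d^2\\ a^2c^2&ac&b^2c^2+bc&b^2c^2+bc+1&bd&b^2d^2\\ 0&c^2&cd&cd&d^2&0\\ c^4&0&c^2d^2&c^2d^2&0&d^4\end{pmatrix},\qquad a,b,c,d\in\mathbb F_q,\ ad+bc=1.$$ For $i=1,2,3$ let $\mathcal Z_i$ be the $\tilde G_1$-orbit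 of the point $U_1+\omega^{i-1}U_5$. For $i=0,3$ let $\mathcal L_i$ be the set of lines contained in $\mathcal Q(4,q)$ that meet $\mathcal Y$ in exactly $i$ points. Then every line of $\mathcal L_3$ has $3$ points in common with $\mathcal Y$, exactly $\bigl(q-(-1)^{n/2}2\sqrt q-2\bigr)/3$ points in common with $\mathcal Z_1$, and exactly $\bigl(q+(-1)^{n/2}\sqrt q-2\bigr)/3$ points in common with each of $\mathcal Z_2$ and $\mathcal Z_3$. Every line of $\mathcal L_0$ has exactly $\bigl(q-(-1)^{n/2}2\sqrt q+1\bigr)/3$ points in common with $\mathcal Z_1$ and exactly $\bigl(q+(-1)^{n/2}\sqrt q+1\bigr)/3$ points in common with each of $\mathcal Z_2$ and $\mathcal Z_3$. -/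

import Mathlib

open scoped LinearAlgebra.Projectivization

namespace TwistedCubic

/-- The projective space `PG(5, F)`. The homogeneous coordinates `X₁, …, X₆` are the coordinates
with indices `0, …, 5`. -/
abbrev PG5 (F : Type*) [Field F] : Type _ := ℙ F (Fin 6 → F)

section Forms

variable {F : Type*} [Field F]

/-- The quadratic form `X₁X₆ + X₂X₅ + X₃X₄` of the Klein quadric. -/
def kleinForm (v : Fin 6 → F) : F := v 0 * v 5 + v 1 * v 4 + v 2 * v 3

/-- The form `F_h = X₁ X₅^(2^h) + X₂^(2^h) X₆`, homogeneous of degree `2^h + 1`. -/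
def cubicForm (h : ℕ) (v : Fin 6 → F) : F := v 0 * v 4 ^ 2 ^ h + v 1 ^ 2 ^ h * v 5

theorem kleinForm_smul (t : F) (v : Fin 6 → F) :
    kleinForm (t • v) = t ^ 2 * kleinForm v := by
  simp only [kleinForm, Pi.smul_apply, smul_eq_mul]; ring

theorem cubicForm_smul (h : ℕ) (t : F) (v : Fin 6 → F) :
    cubicForm h (t • v) = t ^ (2 ^ h + 1) * cubicForm h v := by
  simp only [cubicForm, Pi.smul_apply, smul_eq_mul, mul_pow, pow_succ]; ring

end Forms

section Geometry

variable (F : Type*) [Field F]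

/-- The Klein quadric `Q⁺(5, F)`. -/
def kleinQuadric : Set (PG5 F) := {P | kleinForm P.rep = 0}

/-- The hyperplane `Π : X₃ + X₄ = 0`. -/
def hyperplanePi : Set (PG5 F) := {P | P.rep 2 + P.rep 3 = 0}

/-- The parabolic quadric `Q(4, F) = Q⁺(5, F) ∩ Π`. -/
def parabolicQuadric : Set (PG5 F) := kleinQuadric F ∩ hyperplanePi F

/-- The hypersurface `𝒴` of `Π` given by `F_h = 0`. -/
def hypersurfaceY (h : ℕ) : Set (PG5 F) := {P | P ∈ hyperplanePi F ∧ cubicForm h P.rep = 0}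

variable {F}

theorem mk_mem_kleinQuadric {v : Fin 6 → F} (hv : v ≠ 0) :
    Projectivization.mk F v hv ∈ kleinQuadric F ↔ kleinForm v = 0 := by
  obtain ⟨a, ha⟩ := Projectivization.exists_smul_eq_mk_rep F v hv
  simp [kleinQuadric, ← ha, Units.smul_def, kleinForm_smul]

theorem mk_mem_hyperplanePi {v : Fin 6 → F} (hv : v ≠ 0) :
    Projectivization.mk F v hv ∈ hyperplanePi F ↔ v 2 + v 3 = 0 := by
  obtain ⟨a, ha⟩ := Projectivization.exists_smul_eq_mk_rep F v hv
  simp [hyperplanePi, ← ha, Units.smul_def, ← mul_add]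

theorem mk_mem_hypersurfaceY {h : ℕ} {v : Fin 6 → F} (hv : v ≠ 0) :
    Projectivization.mk F v hv ∈ hypersurfaceY F h ↔ v 2 + v 3 = 0 ∧ cubicForm h v = 0 := by
  have h1 := mk_mem_hyperplanePi hv
  obtain ⟨a, ha⟩ := Projectivization.exists_smul_eq_mk_rep F v hv
  simp [hypersurfaceY, h1, ← ha, Units.smul_def, cubicForm_smul]

/-- The set of points of the projective subspace given by the vector subspace `ℓ`. -/
def pointsOn (ℓ : Submodule F (Fin 6 → F)) : Set (PG5 F) := {P | P.submodule ≤ ℓ}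

variable (F)

/-- The lines of `PG(5, F)` contained in `Q(4, F)`, as two-dimensional vector subspaces. -/
def quadricLines : Set (Submodule F (Fin 6 → F)) :=
  {ℓ | Module.finrank F ℓ = 2 ∧ pointsOn ℓ ⊆ parabolicQuadric F}

/-- The class `ℒ_i`: the lines of `Q(4, F)` meeting `𝒴` in exactly `i` points
(for `F` finite). -/
def lineClass (h i : ℕ) : Set (Submodule F (Fin 6 → F)) :=
  {ℓ | ℓ ∈ quadricLines F ∧ (pointsOn ℓ ∩ hypersurfaceY F h).ncard = i}

end Geometry

section Group

variable {F : Type*} [Field F]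

/-- The matrix `M̃_{a,b,c,d}`, acting on column vectors. -/
def tildeM (h : ℕ) (a b c d : F) : Matrix (Fin 6) (Fin 6) F :=
  !![a ^ 2 ^ (h + 1), 0, a ^ 2 ^ h * b ^ 2 ^ h, a ^ 2 ^ h * b ^ 2 ^ h, 0, b ^ 2 ^ (h + 1);
     0, a ^ 2, a * b, a * b, b ^ 2, 0;
     a ^ 2 ^ h * c ^ 2 ^ h, a * c, b ^ 2 ^ h * c ^ 2 ^ h + b * c + 1,
       b ^ 2 ^ h * c ^ 2 ^ h + b * c, b * d, b ^ 2 ^ h * d ^ 2 ^ h;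
     a ^ 2 ^ h * c ^ 2 ^ h, a * c, b ^ 2 ^ h * c ^ 2 ^ h + b * c,
       b ^ 2 ^ h * c ^ 2 ^ h + b * c + 1, b * d, b ^ 2 ^ h * d ^ 2 ^ h;
     0, c ^ 2, c * d, c * d, d ^ 2, 0;
     c ^ 2 ^ (h + 1), 0, c ^ 2 ^ h * d ^ 2 ^ h, c ^ 2 ^ h * d ^ 2 ^ h, 0, d ^ 2 ^ (h + 1)]

theorem tildeM_one (h : ℕ) : tildeM h (1 : F) 0 0 1 = 1 := by
  ext i j
  fin_cases i <;> fin_cases j <;> simp [tildeM]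

/-- The point `R_i = U₁ + ω^(i-1) U₅`, for `i ≥ 1`. -/
def pointR (ω : F) (i : ℕ) : PG5 F :=
  Projectivization.mk F ![1, 0, 0, 0, ω ^ (i - 1), 0] (fun e => one_ne_zero (congrFun e 0))

variable [CharP F 2]

theorem tildeM_mul (h : ℕ) {a b c d a' b' c' d' : F} (H : a * d + b * c = 1)
    (H' : a' * d' + b' * c' = 1) :
    tildeM h a b c d * tildeM h a' b' c' d' =
      tildeM h (a * a' + b * c') (a * b' + b * d') (c * a' + d * c') (c * b' + d * d') := by
  have h2 : (2 : F) = 0 := CharTwo.two_eq_zero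
  have P : ∀ x y : F, (x + y) ^ 2 ^ h = x ^ 2 ^ h + y ^ 2 ^ h := fun x y => add_pow_char_pow x y 2 h
  have K : a ^ 2 ^ h * d ^ 2 ^ h + b ^ 2 ^ h * c ^ 2 ^ h = 1 := by
    rw [← mul_pow, ← mul_pow, ← P, H, one_pow]
  have K' : a' ^ 2 ^ h * d' ^ 2 ^ h + b' ^ 2 ^ h * c' ^ 2 ^ h = 1 := by
    rw [← mul_pow, ← mul_pow, ← P, H', one_pow]
  ext i j
  fin_cases i <;> fin_cases j <;>
    simp [tildeM, Matrix.mul_apply, Fin.sum_univ_succ, pow_succ 2 h, pow_mul, P, mul_pow] <;>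
    grind

theorem tildeM_mul_inv (h : ℕ) {a b c d : F} (H : a * d + b * c = 1) :
    tildeM h d b c a * tildeM h a b c d = 1 := by
  rw [tildeM_mul h (by rw [mul_comm d a]; exact H) H, ← tildeM_one h]
  have h2 : (2 : F) = 0 := CharTwo.two_eq_zero
  congr 1 <;> grind

variable (F)

/-- The group `G̃_h` of all projectivities represented by the matrices `M̃_{a,b,c,d}` with
`ad + bc = 1`, as a group of linear automorphisms of `F⁶`. -/
def tildeG (h : ℕ) : Subgroup (LinearMap.GeneralLinearGroup F (Fin 6 → F)) where
  carrier := {g | ∃ a b c d : F, a * d + b * c = 1 ∧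
    (g : (Fin 6 → F) →ₗ[F] (Fin 6 → F)) = Matrix.toLin' (tildeM h a b c d)}
  one_mem' := ⟨1, 0, 0, 1, by simp, by rw [tildeM_one]; simp; rfl⟩
  mul_mem' := by
    rintro g g' ⟨a, b, c, d, H, hg⟩ ⟨a', b', c', d', H', hg'⟩
    refine ⟨a * a' + b * c', a * b' + b * d', c * a' + d * c', c * b' + d * d', ?_, ?_⟩
    · have h2 : (2 : F) = 0 := CharTwo.two_eq_zero
      grind
    · rw [← tildeM_mul h H H', Matrix.toLin'_mul, ← hg, ← hg']; rfl
  inv_mem' := by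
    rintro g ⟨a, b, c, d, H, hg⟩
    refine ⟨d, b, c, a, by rw [mul_comm d a]; exact H, ?_⟩
    have key : Matrix.toLin' (tildeM h d b c a) * (g : (Fin 6 → F) →ₗ[F] (Fin 6 → F)) = 1 := by
      rw [hg, Module.End.mul_eq_comp, ← Matrix.toLin'_mul, tildeM_mul_inv h H, Matrix.toLin'_one]
      rfl
    exact Units.inv_eq_of_mul_eq_one_left key

variable {F}

/-- The `G̃_h`-orbit `𝒵_i` of the point `R_i`. -/
def orbitZ (h : ℕ) (ω : F) (i : ℕ) : Set (PG5 F) := MulAction.orbit (tildeG F h) (pointR ω i)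

end Group

end TwistedCubic

/-! Let a line of `𝒬(4,q)` meet `𝒴` in 0 or 3 points. It has no point with `X₂ = X₅ = 0`, since the
cubic form would have a multiple zero there. So `w = (X₂, X₅)` are coordinates on the line, `X₁` and
`X₆` are given by a matrix `A` in `w`, and vanishing of the Klein form forces `det A = 1`. The cubic
form becomes the binary cubic `f(w) = det(A w, w^(2))`, where `w^(2)` squares the coordinates.

On `𝒬(4,q)` the orbit `𝒵_i` consists of the points whose cubic form lies in the class of
`ω^(2(i-1))` modulo nonzero cubes (`mk_mem_orbitZ_iff`). It remains to count the values of `f` in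
each cube class.

The map `σ(w) = A⁻¹ w^(2)` satisfies `f(σ w) = f(w)²`. Squaring exchanges the two classes of
noncubes, so `𝒵₂` and `𝒵₃` meet the line equally often. Counting all points gives one linear
equation for the two remaining numbers.

A second equation comes from the sum over `w` of `g(f(w))`, where `g(c) = ∑ ψ(c y³)` and `ψ` is the
sign of the trace. With `r = (-1)^(n/2) √q`, `g` is `q` at 0, `-2r` on nonzero cubes and `r` on
noncubes: Weil's squaring trick gives the squares of these values, and congruence modulo 3 gives the
signs. Homogeneity of `f` reduces the double sum to `S = ∑ ψ(f(w))`. With three zeros, `f` is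
equivalent to `xy(x+y)` and `S = 4q`. With none, `S² = q²`, and integrality modulo 3 selects `S =
q`. -/

namespace TwistedCubic

/-! ### Cubic exponential sums in characteristic two. -/

section CharacterSums

variable {F : Type*} [Field F]

/-- A finite field of characteristic two has a nontrivial sign-valued additive character that is
invariant under squaring. -/
theorem exists_addChar_sq_invariant (F : Type*) [Field F] [Finite F] [CharP F 2] :
    ∃ ψ : AddChar F ℤ, (∀ x, ψ (x ^ 2) = ψ x) ∧ ∃ a, ψ a ≠ 1 := by
  let _ : Algebra (ZMod 2) F := ZMod.algebra F 2
  let χ : AddChar (ZMod 2) ℤ :=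
    { toFun := fun x => if x = 0 then 1 else -1
      map_zero_eq_one' := by simp
      map_add_eq_mul' := by decide }
  -- The character is the sign of the absolute trace, which is Frobenius invariant and not
  -- identically zero.
  refine ⟨χ.compAddMonoidHom (Algebra.trace (ZMod 2) F).toAddMonoidHom, fun x => ?_, ?_⟩
  · have h := Algebra.trace_eq_of_algEquiv
      (FiniteField.frobeniusAlgEquivOfAlgebraic (ZMod 2) F) x
    rw [FiniteField.coe_frobeniusAlgEquivOfAlgebraic, ZMod.card] at h
    exact congrArg χ h
  · obtain ⟨a, ha⟩ : ∃ a, Algebra.trace (ZMod 2) F a ≠ 0 := by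
      by_contra! h
      exact Algebra.trace_ne_zero (ZMod 2) F (LinearMap.ext h)
    refine ⟨a, ?_⟩
    change (if Algebra.trace (ZMod 2) F a = 0 then (1 : ℤ) else -1) ≠ 1
    rw [if_neg ha]
    decide

theorem addChar_mul_self [CharP F 2] (ψ : AddChar F ℤ) (x : F) : ψ x * ψ x = 1 := by
  rw [← AddChar.map_add_eq_mul, CharTwo.add_self_eq_zero, AddChar.map_zero_eq_one]

theorem sum_addChar_comp_eq_zero {G : Type*} [AddCommGroup G] [Fintype G] (ψ : AddChar F ℤ)
    (B : G →+ F) (g : G) (hg : ψ (B g) ≠ 1) : ∑ y, ψ (B y) = 0 := by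
  have h : ψ.compAddMonoidHom B ≠ 1 := fun h => hg (by
    simpa using DFunLike.congr_fun h g)
  simpa using AddChar.sum_eq_zero_of_ne_one h

/-- Weil's squaring trick for the character sum of a quadratic map. -/
theorem sq_sum_addChar [CharP F 2] {G : Type*} [AddCommGroup G] [Fintype G] (ψ : AddChar F ℤ)
    (Q : G → F) (B : G → G → F) (hQ : ∀ y d, Q (y + d) = Q y + Q d + B d y) :
    (∑ y, ψ (Q y)) ^ 2 = ∑ d, ψ (Q d) * ∑ y, ψ (B d y) := by
  have h : ∀ y, ∑ z, ψ (Q z) = ∑ d, ψ (Q (y + d)) := fun y =>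
    (Equiv.sum_comp (Equiv.addLeft y) fun z => ψ (Q z)).symm
  calc (∑ y, ψ (Q y)) ^ 2 = ∑ y, ψ (Q y) * ∑ d, ψ (Q (y + d)) := by
        rw [sq, Finset.sum_mul]
        exact Finset.sum_congr rfl fun y _ => by rw [← h y]
    _ = ∑ y, ∑ d, ψ (Q d) * ψ (B d y) := by
        refine Finset.sum_congr rfl fun y _ => ?_
        rw [Finset.mul_sum]
        refine Finset.sum_congr rfl fun d _ => ?_
        -- As `ψ` takes values `±1`, the two factors `ψ (Q y)` cancel and only the polar form still
        -- depends on `y`.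
        rw [hQ, AddChar.map_add_eq_mul, AddChar.map_add_eq_mul, ← mul_assoc, ← mul_assoc,
          addChar_mul_self, one_mul]
    _ = _ := by
        rw [Finset.sum_comm]
        simp_rw [Finset.mul_sum]

theorem cube_eq_cube_iff [CharP F 2] {ζ : F} (hζ : ζ ^ 2 + ζ + 1 = 0) (x y : F) :
    x ^ 3 = y ^ 3 ↔ x = y ∨ x = ζ * y ∨ x = ζ ^ 2 * y := by
  have h2 : (2 : F) = 0 := CharTwo.two_eq_zero
  constructor
  · intro h
    have : (x - y) * ((x - ζ * y) * (x - ζ ^ 2 * y)) = 0 := by grind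
    simpa [sub_eq_zero] using this
  · rintro (rfl | rfl | rfl) <;> grind

variable [Fintype F]

/-- The cubic exponential sum `∑ ψ(c y³)`. -/
def cubicSum (ψ : AddChar F ℤ) (c : F) : ℤ := ∑ y, ψ (c * y ^ 3)

theorem cubicSum_zero (ψ : AddChar F ℤ) : cubicSum ψ 0 = Fintype.card F := by
  simp [cubicSum]

variable [CharP F 2]

theorem exists_sq_mul_eq (a : F) {K : F} (hK : K ≠ 0) : ∃ y : F, y ^ 2 * K = a := by
  obtain ⟨y, hy⟩ := FiniteField.isSquare_of_char_two (ringChar.eq F 2) (a / K)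
  exact ⟨y, by rw [sq, ← hy]; field_simp⟩

variable [DecidableEq F]

/-- In characteristic two `y ↦ y² K` is additive, and it is onto when `K ≠ 0`, so orthogonality of
characters applies. -/
theorem sum_addChar_sq_mul (ψ : AddChar F ℤ) (hψ : ∃ a, ψ a ≠ 1) (K : F) :
    ∑ y, ψ (y ^ 2 * K) = if K = 0 then (Fintype.card F : ℤ) else 0 := by
  split_ifs with hK
  · simp [hK]
  · obtain ⟨a, ha⟩ := hψ
    obtain ⟨y, hy⟩ := exists_sq_mul_eq a hK
    refine sum_addChar_comp_eq_zero ψ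
      { toFun := fun y => y ^ 2 * K
        map_zero' := by simp
        map_add' := fun x y => by rw [CharTwo.add_sq, add_mul] } y ?_
    simpa [hy] using ha

theorem card_cube_eq_cube {ζ : F} (hζ : ζ ^ 2 + ζ + 1 = 0) {y : F} (hy : y ≠ 0) :
    (Finset.univ.filter fun x : F => x ^ 3 = y ^ 3).card = 3 := by
  have h2 : (2 : F) = 0 := CharTwo.two_eq_zero
  have : (Finset.univ.filter fun x : F => x ^ 3 = y ^ 3) = {y, ζ * y, ζ ^ 2 * y} := by
    ext x; simp [cube_eq_cube_iff hζ]
  have h3 : ζ ≠ 0 := by rintro rfl; simp at hζ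
  have h1 : ζ ≠ 1 := by rintro rfl; have := @one_ne_zero F; grind
  rw [this, Finset.card_eq_three]
  refine ⟨_, _, _, ?_, ?_, ?_, rfl⟩ <;> intro h
  · exact h1 (mul_right_cancel₀ hy (by rw [← h, one_mul]))
  · have : ζ ^ 2 = 1 := mul_right_cancel₀ hy (by rw [← h, one_mul])
    grind
  · have : ζ ^ 2 = ζ := mul_right_cancel₀ hy h.symm
    have : ζ * ζ = ζ * 1 := by grind
    exact h1 (mul_left_cancel₀ h3 this)

theorem add_pow_four_eq_zero_filter :
    (Finset.univ.filter fun x : F => x + x ^ 4 = 0) =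
      insert 0 (Finset.univ.filter fun x : F => x ^ 3 = 1 ^ 3) := by
  ext x
  have h2 : (2 : F) = 0 := CharTwo.two_eq_zero
  simp only [Finset.mem_filter, Finset.mem_univ, true_and, Finset.mem_insert]
  constructor
  · intro h
    by_cases hx : x = 0
    · exact Or.inl hx
    · right; have : x * (x ^ 3) = x * 1 := by grind
      simpa using mul_left_cancel₀ hx this
  · rintro (rfl | h)
    · simp
    · grind

/-- Cubing is three-to-one on nonzero elements, and `y = 0` contributes 1. This congruence later
fixes the sign of the sum. -/
theorem cubicSum_mod_three {ζ : F} (hζ : ζ ^ 2 + ζ + 1 = 0) (ψ : AddChar F ℤ) (c : F) :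
    (3 : ℤ) ∣ cubicSum ψ c - 1 := by
  have h1 : cubicSum ψ c - 1 = ∑ y ∈ Finset.univ.erase 0, ψ (c * y ^ 3) := by
    rw [cubicSum, ← Finset.add_sum_erase _ _ (Finset.mem_univ (0 : F))]
    simp
  rw [h1, Finset.sum_comp (fun x => ψ (c * x)) (fun y : F => y ^ 3)]
  refine Finset.dvd_sum fun z hz => ?_
  obtain ⟨y, hy, rfl⟩ := Finset.mem_image.1 hz
  have hy0 : y ≠ 0 := Finset.ne_of_mem_erase hy
  have : (Finset.univ.erase (0 : F)).filter (fun x => x ^ 3 = y ^ 3) =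
      Finset.univ.filter fun x : F => x ^ 3 = y ^ 3 := by
    ext x
    simp only [Finset.mem_filter, Finset.mem_erase, Finset.mem_univ, and_true, true_and,
      and_iff_right_iff_imp]
    rintro h rfl
    exact hy0 (by simpa using h.symm)
  rw [this, card_cube_eq_cube hζ hy0]
  simp

theorem sq_cubicSum (ψ : AddChar F ℤ) (hψ2 : ∀ x, ψ (x ^ 2) = ψ x) (hψ : ∃ a, ψ a ≠ 1) (c : F) :
    cubicSum ψ c ^ 2 = ∑ d ∈ Finset.univ.filter (fun d : F => c * d + c ^ 2 * d ^ 4 = 0),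
      ψ (c * d ^ 3) * Fintype.card F := by
  have h2 : (2 : F) = 0 := CharTwo.two_eq_zero
  rw [cubicSum, sq_sum_addChar ψ (fun y => c * y ^ 3) (fun d y => c * y ^ 2 * d + c * y * d ^ 2)
    (fun y d => by grind), Finset.sum_filter]
  refine Finset.sum_congr rfl fun d _ => ?_
  -- Since `ψ (u ^ 2) = ψ u`, the term linear in `y` may be squared and merged with the term in `y ^
  -- 2`.
  have : ∀ y, ψ (c * y ^ 2 * d + c * y * d ^ 2) = ψ (y ^ 2 * (c * d + c ^ 2 * d ^ 4)) := by
    intro y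
    rw [AddChar.map_add_eq_mul, ← hψ2 (c * y * d ^ 2), ← AddChar.map_add_eq_mul]
    congr 1; ring
  simp_rw [this, sum_addChar_sq_mul ψ hψ]
  simp

theorem cubicSum_one {ζ : F} (hζ : ζ ^ 2 + ζ + 1 = 0) (ψ : AddChar F ℤ)
    (hψ2 : ∀ x, ψ (x ^ 2) = ψ x) (hψ : ∃ a, ψ a ≠ 1) {r : ℤ} (hr : r ^ 2 = Fintype.card F)
    (hr3 : (3 : ℤ) ∣ r - 1) : cubicSum ψ 1 = -2 * r := by
  have h := sq_cubicSum ψ hψ2 hψ 1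
  simp only [one_mul, one_pow] at h
  rw [add_pow_four_eq_zero_filter, Finset.sum_insert (by simp)] at h
  rw [Finset.sum_congr rfl (g := fun _ => ψ 1 * (Fintype.card F : ℤ)) (fun d hd => by
    have : d ^ 3 = 1 ^ 3 := (Finset.mem_filter.1 hd).2
    rw [this, one_pow]), Finset.sum_const, card_cube_eq_cube hζ one_ne_zero] at h
  have hm := cubicSum_mod_three hζ ψ 1
  have hq : (0 : ℤ) < Fintype.card F := by exact_mod_cast Fintype.card_pos
  -- If `ψ 1 = -1`, the square of the sum would be `q - 3q < 0`.
  have h1 : ψ 1 = 1 := by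
    rcases mul_self_eq_one_iff.1 (addChar_mul_self ψ (1 : F)) with h1 | h1
    · exact h1
    · rw [h1] at h
      simp at h
      nlinarith [sq_nonneg (cubicSum ψ 1)]
  rw [h1] at h
  simp at h
  have : (cubicSum ψ 1 - 2 * r) * (cubicSum ψ 1 + 2 * r) = 0 := by linear_combination h - 4 * hr
  rcases mul_eq_zero.1 this with h | h <;> omega

theorem cubicSum_of_ne_cube {ζ : F} (hζ : ζ ^ 2 + ζ + 1 = 0) (ψ : AddChar F ℤ)
    (hψ2 : ∀ x, ψ (x ^ 2) = ψ x) (hψ : ∃ a, ψ a ≠ 1) {r : ℤ} (hr : r ^ 2 = Fintype.card F)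
    (hr3 : (3 : ℤ) ∣ r - 1) {c : F} (hc : ∀ y, c ≠ y ^ 3) : cubicSum ψ c = r := by
  have h2 : (2 : F) = 0 := CharTwo.two_eq_zero
  have h := sq_cubicSum ψ hψ2 hψ c
  have hc0 : c ≠ 0 := by simpa using hc 0
  -- A nonzero solution `d` would give `c * d ^ 3 = 1`, making `c` a cube.
  have : Finset.univ.filter (fun d : F => c * d + c ^ 2 * d ^ 4 = 0) = {0} := by
    ext d
    simp only [Finset.mem_filter, Finset.mem_univ, true_and, Finset.mem_singleton]
    refine ⟨fun h => ?_, by rintro rfl; simp⟩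
    by_contra hd
    refine hc d⁻¹ ?_
    have : c * d * (c * d ^ 3) = c * d * 1 := by grind
    have := mul_left_cancel₀ (mul_ne_zero hc0 hd) this
    field_simp
    exact this
  rw [this] at h
  simp at h
  have hm := cubicSum_mod_three hζ ψ c
  have : (cubicSum ψ c - r) * (cubicSum ψ c + r) = 0 := by linear_combination h - hr
  rcases mul_eq_zero.1 this with h | h <;> omega

theorem cubicSum_cube {ζ : F} (hζ : ζ ^ 2 + ζ + 1 = 0) (ψ : AddChar F ℤ)
    (hψ2 : ∀ x, ψ (x ^ 2) = ψ x) (hψ : ∃ a, ψ a ≠ 1) {r : ℤ} (hr : r ^ 2 = Fintype.card F)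
    (hr3 : (3 : ℤ) ∣ r - 1) {z : F} (hz : z ≠ 0) : cubicSum ψ (z ^ 3) = -2 * r := by
  rw [← cubicSum_one hζ ψ hψ2 hψ hr hr3, cubicSum, cubicSum,
    ← Equiv.sum_comp (Equiv.mulLeft₀ z hz) (fun y => ψ (1 * y ^ 3))]
  simp [mul_pow]

end CharacterSums

end TwistedCubic

namespace TwistedCubic

/-! ### Classes of nonzero elements modulo cubes. -/

section CubeClasses

variable {F : Type*} [Field F]

/-- The coset of the nonzero cubes that contains `ω ^ j`. -/
def cubeClass (ω : F) (j : ℕ) : Set F := {x | ∃ y : F, y ≠ 0 ∧ x = ω ^ j * y ^ 3}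

theorem ne_zero_of_mem_cubeClass {ω : F} (hω : ω ≠ 0) {j : ℕ} {x : F}
    (h : x ∈ cubeClass ω j) : x ≠ 0 := by
  obtain ⟨y, hy, rfl⟩ := h
  exact mul_ne_zero (pow_ne_zero _ hω) (pow_ne_zero _ hy)

theorem exists_mem_cubeClass {ω : Fˣ} (hω : ∀ x : Fˣ, x ∈ Subgroup.zpowers ω) {x : F}
    (hx : x ≠ 0) :
    x ∈ cubeClass (ω : F) 0 ∨ x ∈ cubeClass (ω : F) 2 ∨ x ∈ cubeClass (ω : F) 4 := by
  obtain ⟨k, hk⟩ := hω (Units.mk0 x hx)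
  have key : ∀ (j : ℕ) (m : ℤ), k = j + 3 * m → x ∈ cubeClass (ω : F) j := fun j m h => by
    refine ⟨((ω ^ m : Fˣ) : F), Units.ne_zero _, ?_⟩
    have h1 : ω ^ k = ω ^ j * (ω ^ m) ^ 3 := by
      rw [h, zpow_add, zpow_natCast, mul_comm 3 m, zpow_mul]; rfl
    have h2 : ω ^ k = Units.mk0 x hx := hk
    rw [h2] at h1
    simpa using congrArg Units.val h1
  -- The representatives are the exponents 0, 2, 4 attached to `𝒵₁`, `𝒵₂`, `𝒵₃`; 4 stands for
  -- residue 1.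
  have : k % 3 = 0 ∨ k % 3 = 2 ∨ k % 3 = 1 := by omega
  rcases this with h | h | h
  · exact Or.inl (key 0 (k / 3) (by push_cast; omega))
  · exact Or.inr (Or.inl (key 2 (k / 3) (by push_cast; omega)))
  · exact Or.inr (Or.inr (key 4 (k / 3 - 1) (by push_cast; omega)))

/-- The order `q - 1` of `ω` is divisible by 3, so exponents of `ω` are well defined modulo 3. -/
theorem generator_pow_ne_cube [Finite F] {ω : Fˣ} (hω : ∀ x : Fˣ, x ∈ Subgroup.zpowers ω)
    (hq : Nat.card F ≡ 1 [MOD 3]) {m : ℤ} (hm : ¬ (3 : ℤ) ∣ m) (y : Fˣ) : ω ^ m ≠ y ^ 3 := by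
  obtain ⟨l, rfl⟩ := hω y
  intro h
  have h1 : ω ^ (m - 3 * l) = 1 := by
    rw [zpow_sub, h, mul_comm 3 l, zpow_mul]
    exact mul_inv_cancel (G := Fˣ) _
  have h2 := orderOf_dvd_iff_zpow_eq_one.2 h1
  rw [orderOf_eq_card_of_forall_mem_zpowers hω, Nat.card_units] at h2
  have h3 : 3 ∣ Nat.card F - 1 := (Nat.modEq_iff_dvd' Finite.card_pos).1 hq.symm
  have h4 : (3 : ℤ) ∣ m - 3 * l := (Int.natCast_dvd_natCast.2 h3).trans h2
  omega

theorem cubeClass_disjoint [Finite F] {ω : Fˣ} (hω : ∀ x : Fˣ, x ∈ Subgroup.zpowers ω)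
    (hq : Nat.card F ≡ 1 [MOD 3]) {i j : ℕ} (hij : ¬ (3 : ℤ) ∣ (i : ℤ) - j) {x : F}
    (hi : x ∈ cubeClass (ω : F) i) : x ∉ cubeClass (ω : F) j := by
  rintro ⟨z, hz, h⟩
  obtain ⟨y, hy, rfl⟩ := hi
  refine generator_pow_ne_cube hω hq hij (Units.mk0 z hz / Units.mk0 y hy) ?_
  have : ω ^ i * Units.mk0 y hy ^ 3 = ω ^ j * Units.mk0 z hz ^ 3 := Units.ext (by simpa using h)
  rw [zpow_sub, zpow_natCast, zpow_natCast, div_pow, div_eq_mul_inv, ← div_eq_mul_inv,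
    ← div_eq_mul_inv, div_eq_div_iff_mul_eq_mul, this, mul_comm]

theorem sq_mem_cubeClass {ω : F} (hω : ω ≠ 0) {x : F} :
    (x ∈ cubeClass ω 2 → x ^ 2 ∈ cubeClass ω 4) ∧ (x ∈ cubeClass ω 4 → x ^ 2 ∈ cubeClass ω 2) := by
  constructor
  · rintro ⟨y, hy, rfl⟩
    exact ⟨y ^ 2, pow_ne_zero _ hy, by ring⟩
  · rintro ⟨y, hy, rfl⟩
    exact ⟨ω ^ 2 * y ^ 2, mul_ne_zero (pow_ne_zero _ hω) (pow_ne_zero _ hy), by ring⟩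

theorem exists_cube_root_unity [Finite F] {ω : Fˣ} (hω : ∀ x : Fˣ, x ∈ Subgroup.zpowers ω)
    (hq : Nat.card F ≡ 1 [MOD 3]) : ∃ ζ : F, ζ ^ 2 + ζ + 1 = 0 := by
  have h3 : 3 ∣ Nat.card F - 1 := (Nat.modEq_iff_dvd' Finite.card_pos).1 hq.symm
  obtain ⟨k, hk⟩ := h3
  have ho : orderOf ω = 3 * k := by
    rw [orderOf_eq_card_of_forall_mem_zpowers hω, Nat.card_units, hk]
  have hpos : 0 < 3 * k := ho ▸ orderOf_pos ω
  have h1 : (ω : F) ^ k ≠ 1 := fun h => by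
    have := orderOf_dvd_of_pow_eq_one (x := ω) (n := k) (Units.ext (by simpa using h))
    have := Nat.le_of_dvd (by omega) this
    omega
  have h2 : ((ω : F) ^ k) ^ 3 = 1 := by
    have := pow_orderOf_eq_one ω
    rw [ho] at this
    rw [← pow_mul, mul_comm k 3]
    simpa using congrArg Units.val this
  refine ⟨(ω : F) ^ k, mul_left_cancel₀ (sub_ne_zero.2 h1) ?_⟩
  linear_combination h2

theorem sum_ite_eq_ncard {G : Type*} [Fintype G] (p : G → Prop) [DecidablePred p] (b : ℤ) :
    (∑ w, if p w then b else 0) = {w | p w}.ncard * b := by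
  rw [← Finset.sum_filter, Finset.sum_const, Set.ncard_eq_toFinset_card']
  simp

theorem sum_comp_eq_cubeClass [Finite F] {ω : Fˣ} (hω : ∀ x : Fˣ, x ∈ Subgroup.zpowers ω)
    (hq : Nat.card F ≡ 1 [MOD 3]) {G : Type*} [Fintype G] (f : G → F) (h : F → ℤ) {a b c d : ℤ}
    (ha : h 0 = a) (hb : ∀ x ∈ cubeClass (ω : F) 0, h x = b)
    (hc : ∀ x ∈ cubeClass (ω : F) 2, h x = c) (hd : ∀ x ∈ cubeClass (ω : F) 4, h x = d) :
    ∑ w, h (f w) = {w | f w = 0}.ncard * a + {w | f w ∈ cubeClass (ω : F) 0}.ncard * b +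
      {w | f w ∈ cubeClass (ω : F) 2}.ncard * c + {w | f w ∈ cubeClass (ω : F) 4}.ncard * d := by
  classical
  rw [← sum_ite_eq_ncard, ← sum_ite_eq_ncard, ← sum_ite_eq_ncard, ← sum_ite_eq_ncard,
    ← Finset.sum_add_distrib, ← Finset.sum_add_distrib, ← Finset.sum_add_distrib]
  refine Finset.sum_congr rfl fun w _ => ?_
  have n : ∀ {j}, f w ∈ cubeClass (ω : F) j → f w ≠ 0 := ne_zero_of_mem_cubeClass ω.ne_zero
  by_cases h0 : f w = 0
  · have n' : ∀ j, f w ∉ cubeClass (ω : F) j := fun j hj => n hj h0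
    rw [if_pos h0, if_neg (n' 0), if_neg (n' 2), if_neg (n' 4), h0, ha]
    simp
  · rcases exists_mem_cubeClass hω h0 with h1 | h1 | h1
    · have h2 : f w ∉ cubeClass (ω : F) 2 := cubeClass_disjoint hω hq (by norm_num) h1
      have h3 : f w ∉ cubeClass (ω : F) 4 := cubeClass_disjoint hω hq (by norm_num) h1
      simp [h0, h1, h2, h3, hb _ h1]
    · have h2 : f w ∉ cubeClass (ω : F) 0 := cubeClass_disjoint hω hq (by norm_num) h1
      have h3 : f w ∉ cubeClass (ω : F) 4 := cubeClass_disjoint hω hq (by norm_num) h1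
      simp [h0, h1, h2, h3, hc _ h1]
    · have h2 : f w ∉ cubeClass (ω : F) 0 := cubeClass_disjoint hω hq (by norm_num) h1
      have h3 : f w ∉ cubeClass (ω : F) 2 := cubeClass_disjoint hω hq (by norm_num) h1
      simp [h0, h1, h2, h3, hd _ h1]

/-- After exchanging the sums, `y = 0` contributes the number `q²` of vectors. For `y ≠ 0`,
homogeneity turns `f(w) y³` into `f(y w)`, and `w ↦ y w` is a permutation. -/
theorem sum_cubicSum_comp [Fintype F] (ψ : AddChar F ℤ) (f : F × F → F)
    (hf : ∀ (y : F) w, f (y • w) = y ^ 3 * f w) :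
    ∑ w, cubicSum ψ (f w) =
      (Fintype.card F : ℤ) ^ 2 + (Fintype.card F - 1) * ∑ w, ψ (f w) := by
  classical
  simp only [cubicSum]
  rw [Finset.sum_comm, ← Finset.add_sum_erase _ _ (Finset.mem_univ (0 : F)),
    Finset.sum_congr rfl (g := fun _ => ∑ w, ψ (f w)) (s₁ := Finset.univ.erase 0)]
  · simp [Fintype.card_prod, sq, Nat.cast_sub Fintype.card_pos]
  · intro y hy
    rw [← Equiv.sum_comp (MulAction.toPerm (Units.mk0 y (Finset.ne_of_mem_erase hy)))
      fun w => ψ (f w)]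
    refine Finset.sum_congr rfl fun w _ => ?_
    simp only [MulAction.toPerm_apply, Units.smul_def, Units.val_mk0]
    rw [hf, mul_comm]

end CubeClasses

/-! ### The binary cubic and its semilinear map. -/

section BinaryCubic

variable {F : Type*} [Field F]

/-- The binary cubic form `det (A w, w^(2))` of a `2 × 2` matrix `A`. -/
def binaryCubic (α β γ δ : F) (w : F × F) : F :=
  γ * w.1 ^ 3 + δ * w.1 ^ 2 * w.2 + α * w.1 * w.2 ^ 2 + β * w.2 ^ 3

/-- The semilinear map `w ↦ A⁻¹ w^(2)` of a `2 × 2` matrix `A` of determinant one, in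
characteristic two. -/
def semilinear (α β γ δ : F) (w : F × F) : F × F :=
  (δ * w.1 ^ 2 + β * w.2 ^ 2, γ * w.1 ^ 2 + α * w.2 ^ 2)

theorem binaryCubic_smul (α β γ δ y : F) (w : F × F) :
    binaryCubic α β γ δ (y • w) = y ^ 3 * binaryCubic α β γ δ w := by
  simp only [binaryCubic, Prod.smul_fst, Prod.smul_snd, smul_eq_mul]; ring

theorem binaryCubic_eq_det (α β γ δ : F) (w : F × F) :
    binaryCubic α β γ δ w =
      w.1 * (semilinear α β γ δ w).2 + w.2 * (semilinear α β γ δ w).1 := by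
  simp only [binaryCubic, semilinear]; ring

variable [CharP F 2] {α β γ δ : F}

theorem det_semilinear (hA : α * δ + β * γ = 1) (v w : F × F) :
    (semilinear α β γ δ v).1 * (semilinear α β γ δ w).2 +
      (semilinear α β γ δ v).2 * (semilinear α β γ δ w).1 = (v.1 * w.2 + v.2 * w.1) ^ 2 := by
  have h2 : (2 : F) = 0 := CharTwo.two_eq_zero
  simp only [semilinear]; grind

theorem binaryCubic_semilinear (hA : α * δ + β * γ = 1) (w : F × F) :
    binaryCubic α β γ δ (semilinear α β γ δ w) = binaryCubic α β γ δ w ^ 2 := by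
  rw [binaryCubic_eq_det, det_semilinear hA, ← binaryCubic_eq_det]

theorem semilinear_injective (hA : α * δ + β * γ = 1) :
    Function.Injective (semilinear α β γ δ) := by
  have h2 : (2 : F) = 0 := CharTwo.two_eq_zero
  rintro ⟨s, t⟩ ⟨s', t'⟩ h
  simp only [semilinear, Prod.mk.injEq] at h
  obtain ⟨h, h'⟩ := h
  have a : s ^ 2 = s' ^ 2 := by grind
  have b : t ^ 2 = t' ^ 2 := by grind
  exact Prod.ext (CharTwo.sq_injective a) (CharTwo.sq_injective b)

/-- The injective semilinear map squares the values of the cubic, hence carries each of the two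
noncube classes into the other. -/
theorem ncard_cubeClass_two_eq_four [Finite F] {ω : F} (hω : ω ≠ 0) (hA : α * δ + β * γ = 1) :
    {w | binaryCubic α β γ δ w ∈ cubeClass ω 2}.ncard =
      {w | binaryCubic α β γ δ w ∈ cubeClass ω 4}.ncard := by
  refine le_antisymm ?_ ?_ <;>
    refine Set.ncard_le_ncard_of_injOn (semilinear α β γ δ) (fun w hw => ?_)
      (semilinear_injective hA).injOn (Set.toFinite _) <;>
    simp only [Set.mem_ofPred_eq, binaryCubic_semilinear hA] at hw ⊢
  · exact (sq_mem_cubeClass hω).1 hw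
  · exact (sq_mem_cubeClass hω).2 hw

/-- Since `f(w) = det(w, σ w)`, a nonzero zero of `f` is an eigenvector of `σ`, say `σ w = l w`. As
`σ` scales by squares, `l⁻¹ w` is fixed. -/
theorem exists_smul_fixed (hA : α * δ + β * γ = 1) {w : F × F} (hw : w ≠ 0)
    (h : binaryCubic α β γ δ w = 0) : ∃ μ : F, μ ≠ 0 ∧ semilinear α β γ δ (μ • w) = μ • w := by
  have h2 : (2 : F) = 0 := CharTwo.two_eq_zero
  have key : ∃ l : F, semilinear α β γ δ w = l • w := by
    rw [binaryCubic_eq_det] at h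
    obtain ⟨s, t⟩ := w
    generalize semilinear α β γ δ (s, t) = v at h ⊢
    obtain ⟨x, y⟩ := v
    simp only [ne_eq, Prod.mk_eq_zero, not_and_or] at hw h ⊢
    rcases hw with hs | ht
    · refine ⟨x / s, ?_⟩
      simp only [Prod.smul_mk, smul_eq_mul, Prod.mk.injEq]
      field_simp
      exact ⟨trivial, by grind⟩
    · refine ⟨y / t, ?_⟩
      simp only [Prod.smul_mk, smul_eq_mul, Prod.mk.injEq]
      field_simp
      exact ⟨by grind, trivial⟩
  obtain ⟨l, hl⟩ := key
  have hl0 : l ≠ 0 := by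
    rintro rfl
    refine hw (semilinear_injective hA (hl.trans ?_))
    ext <;> simp [semilinear]
  refine ⟨l⁻¹, inv_ne_zero hl0, ?_⟩
  have : semilinear α β γ δ (l⁻¹ • w) = (l⁻¹ ^ 2) • semilinear α β γ δ w := by
    ext <;> simp only [semilinear, Prod.smul_fst, Prod.smul_snd, smul_eq_mul] <;> ring
  rw [this, hl, smul_smul]
  congr 1
  field_simp

end BinaryCubic

end TwistedCubic

namespace TwistedCubic

/-! ### The sum of `ψ` over a binary cubic, and the resulting counts. -/

section BinaryCubicSums

variable {F : Type*} [Field F] [Fintype F] [CharP F 2] {α β γ δ : F}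

theorem sum_addChar_split_cubic [DecidableEq F] {ζ : F} (hζ : ζ ^ 2 + ζ + 1 = 0) (ψ : AddChar F ℤ)
    (hψ2 : ∀ x, ψ (x ^ 2) = ψ x) (hψ : ∃ a, ψ a ≠ 1) :
    ∑ w : F × F, ψ (w.1 * w.2 ^ 2 + w.1 ^ 2 * w.2) = 4 * (Fintype.card F : ℤ) := by
  have : ∀ x y : F, ψ (x * y ^ 2 + x ^ 2 * y) = ψ (y ^ 2 * (x + x ^ 4)) := by
    intro x y
    rw [AddChar.map_add_eq_mul, ← hψ2 (x ^ 2 * y), ← AddChar.map_add_eq_mul]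
    congr 1; ring
  rw [Fintype.sum_prod_type]
  simp_rw [this, sum_addChar_sq_mul ψ hψ]
  rw [← Finset.sum_filter, add_pow_four_eq_zero_filter, Finset.sum_const,
    Finset.card_insert_of_notMem (by simp), card_cube_eq_cube hζ one_ne_zero]
  simp

/-- A pair of independent fixed vectors of the semilinear map brings the cubic to the form
`xy(x + y)`. -/
theorem sum_addChar_binaryCubic_of_fixed {ζ : F} (hζ : ζ ^ 2 + ζ + 1 = 0) (ψ : AddChar F ℤ)
    (hψ2 : ∀ x, ψ (x ^ 2) = ψ x) (hψ : ∃ a, ψ a ≠ 1) {v w : F × F}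
    (hv : semilinear α β γ δ v = v) (hw : semilinear α β γ δ w = w)
    (hvw : v.1 * w.2 + v.2 * w.1 = 1) :
    ∑ w, ψ (binaryCubic α β γ δ w) = 4 * (Fintype.card F : ℤ) := by
  classical
  have h2 : (2 : F) = 0 := CharTwo.two_eq_zero
  rw [← sum_addChar_split_cubic hζ ψ hψ2 hψ]
  obtain ⟨a, b⟩ := v
  obtain ⟨c, d⟩ := w
  simp only [semilinear, Prod.mk.injEq] at hv hw hvw
  obtain ⟨h1, h3⟩ := hv
  obtain ⟨h4, h5⟩ := hw
  have hinj : Function.Injective fun p : F × F => (p.1 * a + p.2 * c, p.1 * b + p.2 * d) := by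
    rintro ⟨x, y⟩ ⟨x', y'⟩ h
    simp only [Prod.mk.injEq] at h
    obtain ⟨e, e'⟩ := h
    exact Prod.ext (by grind) (by grind)
  rw [← (Finite.injective_iff_bijective.1 hinj).sum_comp]
  refine Finset.sum_congr rfl fun p _ => congrArg ψ ?_
  obtain ⟨x, y⟩ := p
  -- In the basis of fixed vectors the semilinear map squares the coordinates.
  have e1 : δ * (x * a + y * c) ^ 2 + β * (x * b + y * d) ^ 2 = x ^ 2 * a + y ^ 2 * c := by
    rw [CharTwo.add_sq, CharTwo.add_sq]
    linear_combination x ^ 2 * h1 + y ^ 2 * h4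
  have e2 : γ * (x * a + y * c) ^ 2 + α * (x * b + y * d) ^ 2 = x ^ 2 * b + y ^ 2 * d := by
    rw [CharTwo.add_sq, CharTwo.add_sq]
    linear_combination x ^ 2 * h3 + y ^ 2 * h5
  rw [binaryCubic_eq_det]
  simp only [semilinear, e1, e2]
  linear_combination (x * y ^ 2 + x ^ 2 * y) * hvw + (x ^ 3 * a * b + y ^ 3 * c * d) * h2

/-- More than `q` zeros cannot lie in a single one-dimensional subspace, so there are two
independent ones, which rescale to fixed vectors of `σ`. -/
theorem sum_addChar_binaryCubic_of_card_lt {ζ : F} (hζ : ζ ^ 2 + ζ + 1 = 0) (ψ : AddChar F ℤ)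
    (hψ2 : ∀ x, ψ (x ^ 2) = ψ x) (hψ : ∃ a, ψ a ≠ 1) (hA : α * δ + β * γ = 1)
    (h : Fintype.card F < {w | binaryCubic α β γ δ w = 0}.ncard) :
    ∑ w, ψ (binaryCubic α β γ δ w) = 4 * (Fintype.card F : ℤ) := by
  have hspan : ∀ v : F × F, ∃ w, binaryCubic α β γ δ w = 0 ∧ ∀ c : F, w ≠ c • v := by
    intro v
    by_contra! hv
    have hs : {w | binaryCubic α β γ δ w = 0} ⊆ Set.range fun c : F => c • v := fun w hw => by
      obtain ⟨c, hc⟩ := hv w hw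
      exact ⟨c, hc.symm⟩
    have h1 := Set.ncard_le_ncard hs
    have h3 : (Set.range fun c : F => c • v).ncard ≤ Fintype.card F := by
      rw [← Set.image_univ, ← Nat.card_eq_fintype_card, ← Set.ncard_univ]
      exact Set.ncard_image_le
    omega
  obtain ⟨v, hv, hv0⟩ := hspan 0
  obtain ⟨w, hw, hwv⟩ := hspan v
  have hv1 : v ≠ 0 := by simpa using hv0 0
  have hw1 : w ≠ 0 := by simpa using hwv 0
  obtain ⟨μ, hμ, hμv⟩ := exists_smul_fixed hA hv1 hv
  obtain ⟨ν, hν, hνw⟩ := exists_smul_fixed hA hw1 hw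
  refine sum_addChar_binaryCubic_of_fixed hζ ψ hψ2 hψ hμv hνw ?_
  -- The determinant `k` of two fixed vectors satisfies `k = k²`; being nonzero, it is 1.
  have hk := det_semilinear hA (μ • v) (ν • w)
  rw [hμv, hνw] at hk
  have hk0 : (μ • v).1 * (ν • w).2 + (μ • v).2 * (ν • w).1 ≠ 0 := by
    intro h0
    have h2 : (2 : F) = 0 := CharTwo.two_eq_zero
    obtain ⟨a, b⟩ := v
    obtain ⟨c, d⟩ := w
    simp only [Prod.smul_mk, smul_eq_mul, ne_eq, Prod.mk_eq_zero, not_and_or,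
      Prod.mk.injEq] at h0 hv1 hwv
    have h3 : μ * ν * (a * d + b * c) = 0 := by linear_combination h0
    have h4 : a * d + b * c = 0 := (mul_eq_zero.1 h3).resolve_left (mul_ne_zero hμ hν)
    rcases hv1 with ha | hb
    · rcases hwv (c / a) with h5 | h5 <;> apply h5 <;> field_simp
      grind
    · rcases hwv (d / b) with h5 | h5 <;> apply h5 <;> field_simp
      grind
  rw [sq] at hk
  exact (mul_left_cancel₀ hk0 (by rw [mul_one]; exact hk)).symm

/-- By the squaring trick only those `d` count for which `ψ` of the polar form is trivial. These are
fixed by `σ²`, and without nontrivial zeros of the cubic only `d = 0` is. -/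
theorem sq_sum_addChar_binaryCubic (ψ : AddChar F ℤ) (hψ2 : ∀ x, ψ (x ^ 2) = ψ x)
    (hψ : ∃ a, ψ a ≠ 1) (hA : α * δ + β * γ = 1)
    (h : ∀ w, binaryCubic α β γ δ w = 0 → w = 0) :
    (∑ w, ψ (binaryCubic α β γ δ w)) ^ 2 = (Fintype.card F : ℤ) ^ 2 := by
  classical
  have h2 : (2 : F) = 0 := CharTwo.two_eq_zero
  have fixed : ∀ w, semilinear α β γ δ w = w → w = 0 := fun w hw => h w (by
    rw [binaryCubic_eq_det, hw]; grind)
  have fixed2 : ∀ w, semilinear α β γ δ (semilinear α β γ δ w) = w → w = 0 := fun w hw => by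
    have hadd : ∀ u v, semilinear α β γ δ (u + v) =
        semilinear α β γ δ u + semilinear α β γ δ v := fun u v => by
      ext <;> simp only [semilinear, Prod.fst_add, Prod.snd_add, CharTwo.add_sq] <;> ring
    -- If `σ² w = w` then `w + σ w` is fixed by `σ`, hence zero, so `w` itself is fixed.
    have h3 : w + semilinear α β γ δ w = 0 := fixed _ (by rw [hadd, hw, add_comm])
    refine fixed w ?_
    have h4 := Prod.ext_iff.1 h3
    simp only [Prod.fst_add, Prod.snd_add, Prod.fst_zero, Prod.snd_zero] at h4
    exact Prod.ext (by grind) (by grind)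
  rw [sq_sum_addChar ψ (binaryCubic α β γ δ) (fun d w =>
    γ * (w.1 ^ 2 * d.1 + w.1 * d.1 ^ 2) + δ * (w.1 ^ 2 * d.2 + d.1 ^ 2 * w.2) +
      α * (w.1 * d.2 ^ 2 + d.1 * w.2 ^ 2) + β * (w.2 ^ 2 * d.2 + w.2 * d.2 ^ 2))
    (fun y d => by simp only [binaryCubic, Prod.fst_add, Prod.snd_add]; grind)]
  have key : ∀ d : F × F, (∑ w : F × F, ψ (γ * (w.1 ^ 2 * d.1 + w.1 * d.1 ^ 2) +
      δ * (w.1 ^ 2 * d.2 + d.1 ^ 2 * w.2) +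
      α * (w.1 * d.2 ^ 2 + d.1 * w.2 ^ 2) + β * (w.2 ^ 2 * d.2 + w.2 * d.2 ^ 2))) =
      if d = 0 then (Fintype.card F : ℤ) ^ 2 else 0 := by
    rintro ⟨p, r⟩
    -- Invariance of `ψ` under squaring replaces the part linear in `w` by its square; the sum then
    -- splits over the two coordinates.
    have e : ∀ w : F × F, ψ (γ * (w.1 ^ 2 * p + w.1 * p ^ 2) +
        δ * (w.1 ^ 2 * r + p ^ 2 * w.2) +
        α * (w.1 * r ^ 2 + p * w.2 ^ 2) + β * (w.2 ^ 2 * r + w.2 * r ^ 2)) =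
        ψ (w.1 ^ 2 * (γ * p + δ * r + (γ * p ^ 2 + α * r ^ 2) ^ 2)) *
        ψ (w.2 ^ 2 * (α * p + β * r + (δ * p ^ 2 + β * r ^ 2) ^ 2)) := by
      intro w
      rw [show γ * (w.1 ^ 2 * p + w.1 * p ^ 2) + δ * (w.1 ^ 2 * r + p ^ 2 * w.2) +
        α * (w.1 * r ^ 2 + p * w.2 ^ 2) + β * (w.2 ^ 2 * r + w.2 * r ^ 2) =
        (w.1 ^ 2 * (γ * p + δ * r) + w.2 ^ 2 * (α * p + β * r)) +
        (w.1 * (γ * p ^ 2 + α * r ^ 2) + w.2 * (δ * p ^ 2 + β * r ^ 2)) by ring,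
        AddChar.map_add_eq_mul, ← hψ2 (w.1 * _ + _), ← AddChar.map_add_eq_mul,
        ← AddChar.map_add_eq_mul, CharTwo.add_sq]
      congr 1
      ring
    simp_rw [e]
    rw [Fintype.sum_prod_type]
    simp_rw [← Finset.mul_sum]
    rw [← Finset.sum_mul, sum_addChar_sq_mul ψ hψ, sum_addChar_sq_mul ψ hψ]
    by_cases hd : (p, r) = 0
    · simp only [Prod.mk_eq_zero] at hd
      simp [hd, sq]
    · rw [if_neg hd]
      by_contra hne
      refine hd (fixed2 (p, r) ?_)
      have h3 : γ * p + δ * r + (γ * p ^ 2 + α * r ^ 2) ^ 2 = 0 := by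
        by_contra h3; simp [h3] at hne
      have h4 : α * p + β * r + (δ * p ^ 2 + β * r ^ 2) ^ 2 = 0 := by
        by_contra h4; simp [h4] at hne
      have h5 : (γ * p ^ 2 + α * r ^ 2) ^ 2 = γ * p + δ * r := by grind
      have h6 : (δ * p ^ 2 + β * r ^ 2) ^ 2 = α * p + β * r := by grind
      simp only [semilinear, h5, h6, Prod.mk.injEq]
      exact ⟨by grind, by grind⟩
  rw [Finset.sum_congr rfl fun d _ => by rw [key d]]
  simp [binaryCubic]

variable {ω : Fˣ} {r : ℤ}

/-- The values of a binary cubic on the cube classes, in terms of its number of zeros and its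
character sum. -/
theorem card_mul_sum_addChar_binaryCubic (hω : ∀ x : Fˣ, x ∈ Subgroup.zpowers ω)
    (hq : Nat.card F ≡ 1 [MOD 3]) (hr : r ^ 2 = Fintype.card F) (hr3 : (3 : ℤ) ∣ r - 1)
    {ζ : F} (hζ : ζ ^ 2 + ζ + 1 = 0) (ψ : AddChar F ℤ)
    (hψ2 : ∀ x, ψ (x ^ 2) = ψ x) (hψ : ∃ a, ψ a ≠ 1) (hA : α * δ + β * γ = 1) :
    ((Fintype.card F : ℤ) ^ 2 = {w | binaryCubic α β γ δ w = 0}.ncard +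
      {w | binaryCubic α β γ δ w ∈ cubeClass (ω : F) 0}.ncard +
      2 * {w | binaryCubic α β γ δ w ∈ cubeClass (ω : F) 2}.ncard) ∧
    (Fintype.card F : ℤ) ^ 2 + (Fintype.card F - 1) * ∑ w, ψ (binaryCubic α β γ δ w) =
      {w | binaryCubic α β γ δ w = 0}.ncard * (Fintype.card F : ℤ) +
      {w | binaryCubic α β γ δ w ∈ cubeClass (ω : F) 0}.ncard * (-2 * r) +
      2 * {w | binaryCubic α β γ δ w ∈ cubeClass (ω : F) 2}.ncard * r := by
  classical
  have h24 := ncard_cubeClass_two_eq_four (α := α) (β := β) (γ := γ) (δ := δ) ω.ne_zero hA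
  -- Both noncube classes give the same value `r` of the cubic sum.
  have nc : ∀ j : ℕ, ¬ (3 : ℤ) ∣ j → ∀ x ∈ cubeClass (ω : F) j, cubicSum ψ x = r := by
    intro j hj x hx
    refine cubicSum_of_ne_cube hζ ψ hψ2 hψ hr hr3 fun y hy => ?_
    have hy0 : y ≠ 0 := by
      rintro rfl
      exact ne_zero_of_mem_cubeClass ω.ne_zero hx (by simpa using hy)
    exact cubeClass_disjoint hω hq (j := 0) (by simpa using hj) hx ⟨y, hy0, by simpa using hy⟩
  constructor
  · have h := sum_comp_eq_cubeClass hω hq (binaryCubic α β γ δ) (fun _ => 1) rfl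
      (fun _ _ => rfl) (fun _ _ => rfl) (fun _ _ => rfl)
    rw [← h24] at h
    simp [Fintype.card_prod] at h
    rw [sq, h]; ring
  · rw [← sum_cubicSum_comp ψ _ (fun y w => binaryCubic_smul α β γ δ y w),
      sum_comp_eq_cubeClass hω hq (binaryCubic α β γ δ) (cubicSum ψ) (cubicSum_zero ψ)
      (b := -2 * r) ?_ (nc 2 (by norm_num)) (nc 4 (by norm_num)), ← h24]
    · ring
    · rintro x ⟨y, hy, rfl⟩
      rw [pow_zero, one_mul]
      exact cubicSum_cube hζ ψ hψ2 hψ hr hr3 hy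

/-- The number of points `N`, `N'` on the projective line at which a binary cubic with three zeros
has values in the class of `1`, or of `ω`. -/
theorem binaryCubic_count_three (hω : ∀ x : Fˣ, x ∈ Subgroup.zpowers ω)
    (hq : Nat.card F ≡ 1 [MOD 3]) (hr : r ^ 2 = Fintype.card F) (hr3 : (3 : ℤ) ∣ r - 1)
    (hA : α * δ + β * γ = 1) {N N' : ℤ}
    (hT : ({w | binaryCubic α β γ δ w = 0}.ncard : ℤ) = 1 + (Fintype.card F - 1) * 3)
    (hN : ({w | binaryCubic α β γ δ w ∈ cubeClass (ω : F) 0}.ncard : ℤ) =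
      (Fintype.card F - 1) * N)
    (hN' : ({w | binaryCubic α β γ δ w ∈ cubeClass (ω : F) 2}.ncard : ℤ) =
      (Fintype.card F - 1) * N') :
    3 * N = r ^ 2 - 2 * r - 2 ∧ 3 * N' = r ^ 2 + r - 2 := by
  obtain ⟨ζ, hζ⟩ := exists_cube_root_unity hω hq
  obtain ⟨ψ, hψ2, hψ⟩ := exists_addChar_sq_invariant F
  have hcard : (1 : ℤ) < Fintype.card F := by exact_mod_cast Fintype.one_lt_card
  obtain ⟨h1, h2⟩ := card_mul_sum_addChar_binaryCubic hω hq hr hr3 hζ ψ hψ2 hψ hA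
  rw [sum_addChar_binaryCubic_of_card_lt hζ ψ hψ2 hψ hA (by zify; rw [hT]; linarith)] at h2
  rw [hT, hN, hN', ← hr] at h1 h2
  have hr1 : r ^ 2 - 1 ≠ 0 := by rw [hr]; omega
  have hr0 : r ≠ 0 := by rintro rfl; omega
  have h3 : N + 2 * N' = r ^ 2 - 2 := mul_left_cancel₀ hr1 (by linear_combination -h1)
  have h4 : 2 * (N' - N) = 2 * r :=
    mul_left_cancel₀ hr1 (mul_left_cancel₀ hr0 (by linear_combination -h2))
  omega

/-- The number of points `N`, `N'` on the projective line at which a binary cubic without zeros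
has values in the class of `1`, or of `ω`. -/
theorem binaryCubic_count_zero (hω : ∀ x : Fˣ, x ∈ Subgroup.zpowers ω)
    (hq : Nat.card F ≡ 1 [MOD 3]) (hr : r ^ 2 = Fintype.card F) (hr3 : (3 : ℤ) ∣ r - 1)
    (hA : α * δ + β * γ = 1) {N N' : ℤ}
    (hT : ({w | binaryCubic α β γ δ w = 0}.ncard : ℤ) = 1)
    (hN : ({w | binaryCubic α β γ δ w ∈ cubeClass (ω : F) 0}.ncard : ℤ) =
      (Fintype.card F - 1) * N)
    (hN' : ({w | binaryCubic α β γ δ w ∈ cubeClass (ω : F) 2}.ncard : ℤ) =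
      (Fintype.card F - 1) * N') :
    3 * N = r ^ 2 - 2 * r + 1 ∧ 3 * N' = r ^ 2 + r + 1 := by
  obtain ⟨ζ, hζ⟩ := exists_cube_root_unity hω hq
  obtain ⟨ψ, hψ2, hψ⟩ := exists_addChar_sq_invariant F
  have hcard : (1 : ℤ) < Fintype.card F := by exact_mod_cast Fintype.one_lt_card
  obtain ⟨h1, h2⟩ := card_mul_sum_addChar_binaryCubic hω hq hr hr3 hζ ψ hψ2 hψ hA
  have hzero : ∀ w, binaryCubic α β γ δ w = 0 → w = 0 := by
    intro w hw
    obtain ⟨a, ha⟩ := Set.ncard_eq_one.1 (Nat.cast_injective (R := ℤ) (hT.trans Nat.cast_one.symm))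
    have e1 : w ∈ ({a} : Set (F × F)) := ha ▸ hw
    have e2 : (0 : F × F) ∈ ({a} : Set (F × F)) := by
      rw [← ha]; simp [binaryCubic]
    rw [Set.mem_singleton_iff] at e1 e2
    rw [e1, e2]
  have hS := sq_sum_addChar_binaryCubic ψ hψ2 hψ hA hzero
  rw [hT, hN, hN', ← hr] at h1
  rw [hT, hN, hN', ← hr] at h2
  rw [← hr] at hS
  have hr1 : r ^ 2 - 1 ≠ 0 := by rw [hr]; omega
  have hr0 : r ≠ 0 := by rintro rfl; omega
  have h3 : N + 2 * N' = r ^ 2 + 1 := mul_left_cancel₀ hr1 (by linear_combination -h1)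
  rcases sq_eq_sq_iff_eq_or_eq_neg.1 hS with h | h <;> rw [h] at h2
  · have h4 : 2 * (N' - N) = 2 * r :=
      mul_left_cancel₀ hr1 (mul_left_cancel₀ hr0 (by linear_combination -h2))
    omega
  -- The sign `S = -q` would give `N = N'` and `3 N = r² + 1`, impossible since `r² + 1 ≡ 2` modulo
  -- 3.
  · have h4 : 2 * (N' - N) = 0 :=
      mul_left_cancel₀ hr1 (mul_left_cancel₀ hr0 (by linear_combination -h2))
    obtain ⟨k, hk⟩ := hr3
    have h5 : r = 3 * k + 1 := by omega
    rw [h5] at h3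
    ring_nf at h3
    omega

end BinaryCubicSums

end TwistedCubic

namespace TwistedCubic

/-! ### Passing between points of a line and coordinate vectors. -/

section Points

variable {F : Type*} [Field F]

theorem mk_mem_pointsOn {ℓ : Submodule F (Fin 6 → F)} {v : Fin 6 → F} (hv : v ≠ 0) :
    Projectivization.mk F v hv ∈ pointsOn ℓ ↔ v ∈ ℓ := by
  change (Projectivization.mk F v hv).submodule ≤ ℓ ↔ _
  rw [Projectivization.submodule_mk, Submodule.span_singleton_le_iff_mem]

theorem rep_mem_of_mem_pointsOn {ℓ : Submodule F (Fin 6 → F)} {P : PG5 F} (hP : P ∈ pointsOn ℓ) :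
    P.rep ∈ ℓ := by
  rw [← mk_mem_pointsOn P.rep_nonzero, P.mk_rep]
  exact hP

theorem forms_eq_zero_of_mem_quadricLines {ℓ : Submodule F (Fin 6 → F)} (hℓ : ℓ ∈ quadricLines F)
    {v : Fin 6 → F} (hv : v ∈ ℓ) : kleinForm v = 0 ∧ v 2 + v 3 = 0 := by
  by_cases h0 : v = 0
  · simp [h0, kleinForm]
  · have h := hℓ.2 ((mk_mem_pointsOn h0).2 hv)
    exact ⟨(mk_mem_kleinQuadric h0).1 h.1, (mk_mem_hyperplanePi h0).1 h.2⟩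

/-- The points of a line in a set `S`, counted by coordinate vectors. -/
theorem ncard_vectors_eq [Finite F] {ℓ : Submodule F (Fin 6 → F)} (e : (F × F) ≃ₗ[F] ℓ)
    (S : Set (PG5 F)) (p : F × F → Prop)
    (hp : ∀ (w : F × F) (hw : (e w : Fin 6 → F) ≠ 0),
      Projectivization.mk F (e w : Fin 6 → F) hw ∈ S ↔ p w) :
    {w | w ≠ 0 ∧ p w}.ncard = (Nat.card F - 1) * (pointsOn ℓ ∩ S).ncard := by
  have hne : ∀ w : F × F, (e w : Fin 6 → F) ≠ 0 ↔ w ≠ 0 := fun w => by simp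
  have key : ∀ (P : PG5 F) (hP : P ∈ pointsOn ℓ) (u : Fˣ)
      (h : (e (u • e.symm ⟨P.rep, rep_mem_of_mem_pointsOn hP⟩) : Fin 6 → F) ≠ 0),
      Projectivization.mk F (e (u • e.symm ⟨P.rep, rep_mem_of_mem_pointsOn hP⟩) : Fin 6 → F) h =
        P := by
    intro P hP u h
    conv_rhs => rw [← P.mk_rep]
    rw [Projectivization.mk_eq_mk_iff]
    exact ⟨u, by simp [Units.smul_def]⟩
  have ne : ∀ (P : PG5 F) (hP : P ∈ pointsOn ℓ) (u : Fˣ),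
      u • e.symm ⟨P.rep, rep_mem_of_mem_pointsOn hP⟩ ≠ 0 := by
    intro P hP u h
    rw [Units.smul_def, smul_eq_zero] at h
    rcases h with h | h
    · exact u.ne_zero h
    · rw [LinearEquiv.map_eq_zero_iff] at h
      exact P.rep_nonzero (congrArg Subtype.val h)
  rw [← Nat.card_units, ← Nat.card_coe_set_eq, ← Nat.card_coe_set_eq, ← Nat.card_prod]
  symm
  -- Each point corresponds to the `q - 1` nonzero multiples of its representative.
  let f : Fˣ × ↥(pointsOn ℓ ∩ S) → {w | w ≠ 0 ∧ p w} := fun x =>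
    ⟨x.1 • e.symm ⟨x.2.1.rep, rep_mem_of_mem_pointsOn x.2.2.1⟩, ne _ x.2.2.1 x.1, by
      obtain ⟨u, P, hP⟩ := x
      have h := (hne _).2 (ne P hP.1 u)
      exact (hp _ h).1 ((key P hP.1 u h).symm ▸ hP.2)⟩
  refine Nat.card_congr (Equiv.ofBijective f ⟨?_, ?_⟩)
  · rintro ⟨u, P, hP⟩ ⟨u', P', hP'⟩ h
    have h1 : u • e.symm ⟨P.rep, rep_mem_of_mem_pointsOn hP.1⟩ =
        u' • e.symm ⟨P'.rep, rep_mem_of_mem_pointsOn hP'.1⟩ := congrArg Subtype.val h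
    have h2 : P = P' := by
      rw [← key P hP.1 u ((hne _).2 (ne _ hP.1 u)), ← key P' hP'.1 u' ((hne _).2 (ne _ hP'.1 u'))]
      congr 2
      exact congrArg e h1
    subst h2
    have h3 : e.symm ⟨P.rep, rep_mem_of_mem_pointsOn hP.1⟩ ≠ 0 := by
      simpa using ne P hP.1 1
    have h4 : (u : F) = u' := smul_left_injective F h3 h1
    rw [Units.ext h4]
  · rintro ⟨w, hw, hpw⟩
    have hw' := (hne w).2 hw
    have hPℓ := (mk_mem_pointsOn hw').2 (e w).2
    obtain ⟨u, hu⟩ := Projectivization.exists_smul_eq_mk_rep F _ hw'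
    refine ⟨(u⁻¹, ⟨Projectivization.mk F _ hw', hPℓ, (hp w hw').2 hpw⟩), Subtype.ext ?_⟩
    dsimp only [f]
    have h1 : (⟨(Projectivization.mk F _ hw').rep, rep_mem_of_mem_pointsOn hPℓ⟩ : ℓ) =
        u • e w := Subtype.ext hu.symm
    rw [h1, Units.smul_def, Units.smul_def, map_smul, LinearEquiv.symm_apply_apply, smul_smul]
    simp

theorem ncard_zeros_eq [Finite F] {ℓ : Submodule F (Fin 6 → F)} (e : (F × F) ≃ₗ[F] ℓ)
    (hℓ : ℓ ∈ quadricLines F) (h : ℕ) :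
    {w | cubicForm h (e w : Fin 6 → F) = 0}.ncard =
      1 + (Nat.card F - 1) * (pointsOn ℓ ∩ hypersurfaceY F h).ncard := by
  rw [← ncard_vectors_eq e _ (fun w => cubicForm h (e w : Fin 6 → F) = 0) fun w hw => by
    simp [mk_mem_hypersurfaceY, (forms_eq_zero_of_mem_quadricLines hℓ (e w).2).2]]
  -- The zero vector is a zero of the form but represents no point; it accounts for the summand 1.
  have : {w | cubicForm h (e w : Fin 6 → F) = 0} =
      insert 0 {w | w ≠ 0 ∧ cubicForm h (e w : Fin 6 → F) = 0} := by
    ext w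
    by_cases hw : w = 0
    · simp [hw, cubicForm]
    · simp [hw]
  rw [this, Set.ncard_insert_of_notMem (by simp) (Set.toFinite _), add_comm]

end Points

/-! ### The orbits described by the value of the cubic form. -/

section Orbits

variable {F : Type*} [Field F]

theorem tildeM_one_mulVec (a b c d x : F) :
    (tildeM 1 a b c d).mulVec ![1, 0, 0, 0, x, 0] =
      ![a ^ 4, b ^ 2 * x, a ^ 2 * c ^ 2 + b * d * x, a ^ 2 * c ^ 2 + b * d * x,
        d ^ 2 * x, c ^ 4] := by
  ext i
  fin_cases i <;> simp [tildeM, Matrix.mulVec, dotProduct, Fin.sum_univ_succ]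

variable [CharP F 2]

/-- The element of `G̃_h` with matrix `M̃_{a,b,c,d}`. -/
def tildeGMk (h : ℕ) {a b c d : F} (H : a * d + b * c = 1) : tildeG F h :=
  ⟨⟨Matrix.toLin' (tildeM h a b c d), Matrix.toLin' (tildeM h d b c a), by
      rw [Module.End.mul_eq_comp, ← Matrix.toLin'_mul,
        tildeM_mul_inv h (by rw [mul_comm d a]; exact H), Matrix.toLin'_one]; rfl, by
      rw [Module.End.mul_eq_comp, ← Matrix.toLin'_mul, tildeM_mul_inv h H, Matrix.toLin'_one]
      rfl⟩, a, b, c, d, H, rfl⟩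

/-- The cubic form takes the value `x² (ad + bc)⁴ = x²` at the image of `U₁ + x U₅`, and scaling by
`y` multiplies it by `y³`. Conversely, square roots recover `a, b, c, d` from the coordinates 0, 1,
4, 5; the cubic form then gives `ad + bc = 1`, and the Klein form fixes the two middle coordinates.
-/
theorem mk_mem_orbitZ_iff [Finite F] {ω : F} (hω : ω ≠ 0) (i : ℕ) {v : Fin 6 → F} (hv : v ≠ 0)
    (hv1 : kleinForm v = 0) (hv2 : v 2 + v 3 = 0) :
    Projectivization.mk F v hv ∈ orbitZ 1 ω i ↔ cubicForm 1 v ∈ cubeClass ω (2 * (i - 1)) := by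
  have h2 : (2 : F) = 0 := CharTwo.two_eq_zero
  have hx0 : ω ^ (i - 1) ≠ 0 := pow_ne_zero _ hω
  have hω2 : ω ^ (2 * (i - 1)) = (ω ^ (i - 1)) ^ 2 := by rw [mul_comm, pow_mul]
  simp only [cubeClass, hω2]
  constructor
  · rintro ⟨⟨g, a, b, c, d, H, hg⟩, hgR⟩
    have h1 : Projectivization.mk F v hv =
        g • Projectivization.mk F ![1, 0, 0, 0, ω ^ (i - 1), 0]
          (fun e => one_ne_zero (congrFun e 0)) := hgR.symm
    rw [Projectivization.smul_mk, Projectivization.mk_eq_mk_iff] at h1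
    obtain ⟨u, hu⟩ := h1
    have h3 : g • (![1, 0, 0, 0, ω ^ (i - 1), 0] : Fin 6 → F) =
        (tildeM 1 a b c d).mulVec ![1, 0, 0, 0, ω ^ (i - 1), 0] := by
      rw [← Matrix.toLin'_apply, ← hg]; rfl
    rw [h3, tildeM_one_mulVec] at hu
    refine ⟨u, u.ne_zero, ?_⟩
    rw [← hu, Units.smul_def, cubicForm_smul]
    simp only [cubicForm]
    have H4 : a ^ 4 * d ^ 4 + b ^ 4 * c ^ 4 = 1 := by
      have : (a * d + b * c) ^ 4 = 1 := by rw [H, one_pow]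
      grind
    simp
    linear_combination (u : F) ^ 3 * (ω ^ (i - 1)) ^ 2 * H4
  · rintro ⟨y, hy, h⟩
    have sq : ∀ x : F, ∃ z, z ^ 2 = x := fun x => by
      obtain ⟨z, hz⟩ := FiniteField.isSquare_of_char_two (ringChar.eq F 2) x
      exact ⟨z, by rw [hz, _root_.sq]⟩
    obtain ⟨a2, ha2⟩ := sq (v 0 / y)
    obtain ⟨a, ha⟩ := sq a2
    obtain ⟨c2, hc2⟩ := sq (v 5 / y)
    obtain ⟨c, hc⟩ := sq c2
    obtain ⟨b, hb⟩ := sq (v 1 / (y * ω ^ (i - 1)))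
    obtain ⟨d, hd⟩ := sq (v 4 / (y * ω ^ (i - 1)))
    generalize hx : ω ^ (i - 1) = x at *
    rw [eq_div_iff hy] at ha2 hc2
    rw [eq_div_iff (mul_ne_zero hy hx0)] at hb hd
    rw [← ha] at ha2
    rw [← hc] at hc2
    have e0 : v 0 = y * a ^ 4 := by rw [← ha2]; ring
    have e1 : v 1 = y * (b ^ 2 * x) := by rw [← hb]; ring
    have e4 : v 4 = y * (d ^ 2 * x) := by rw [← hd]; ring
    have e5 : v 5 = y * c ^ 4 := by rw [← hc2]; ring
    have e3 : v 3 = v 2 := by grind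
    have e2 : v 2 = y * (a ^ 2 * c ^ 2 + b * d * x) := by
      apply CharTwo.sq_injective
      simp only [kleinForm, e0, e1, e3, e4, e5] at hv1
      dsimp only
      grind
    have H : a * d + b * c = 1 := by
      have : (a * d + b * c) ^ 4 = 1 := by
        have e : y ^ 3 * x ^ 2 * (a * d + b * c) ^ 4 = y ^ 3 * x ^ 2 * 1 := by
          simp only [cubicForm, e0, e1, e4, e5] at h
          grind
        exact mul_left_cancel₀ (mul_ne_zero (pow_ne_zero _ hy) (pow_ne_zero _ hx0)) e
      apply CharTwo.sq_injective
      apply CharTwo.sq_injective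
      dsimp only
      rw [one_pow, one_pow, ← pow_mul]
      exact this
    refine ⟨tildeGMk 1 H, ?_⟩
    change (tildeGMk 1 H : LinearMap.GeneralLinearGroup F (Fin 6 → F)) •
      Projectivization.mk F ![1, 0, 0, 0, ω ^ (i - 1), 0] _ = _
    rw [Projectivization.smul_mk, Projectivization.mk_eq_mk_iff]
    refine ⟨(Units.mk0 y hy)⁻¹, ?_⟩
    have h3 : (tildeGMk 1 H : LinearMap.GeneralLinearGroup F (Fin 6 → F)) •
        (![1, 0, 0, 0, ω ^ (i - 1), 0] : Fin 6 → F) =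
        (tildeM 1 a b c d).mulVec ![1, 0, 0, 0, ω ^ (i - 1), 0] := by
      rw [← Matrix.toLin'_apply]; rfl
    rw [h3, tildeM_one_mulVec, inv_smul_eq_iff, Units.smul_def, Units.val_mk0, hx]
    ext j
    fin_cases j <;> simp [e0, e1, e2, e3, e4, e5]

end Orbits

/-! ### Lines of the quadric and the binary cubics on them. -/

section Lines

variable {F : Type*} [Field F]

theorem exists_linearEquiv_of_finrank_eq_two {ℓ : Submodule F (Fin 6 → F)}
    (hℓ : Module.finrank F ℓ = 2) {v : Fin 6 → F} (hv : v ∈ ℓ) (hv0 : v ≠ 0) :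
    ∃ e : (F × F) ≃ₗ[F] ℓ, (e (1, 0) : Fin 6 → F) = v := by
  obtain ⟨w, hw, hwv⟩ : ∃ w ∈ ℓ, w ∉ Submodule.span F {v} := by
    by_contra! h
    have h1 := Submodule.finrank_mono (show ℓ ≤ Submodule.span F {v} from h)
    rw [hℓ, finrank_span_singleton hv0] at h1
    omega
  let f : (F × F) →ₗ[F] ℓ :=
    (LinearMap.toSpanSingleton F ℓ ⟨v, hv⟩).coprod (LinearMap.toSpanSingleton F ℓ ⟨w, hw⟩)
  have hf : Function.Injective f := by
    rw [injective_iff_map_eq_zero]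
    rintro ⟨s, t⟩ h
    have h1 : s • v + t • w = 0 := by simpa [f] using congrArg Subtype.val h
    have ht : t = 0 := by
      by_contra ht
      refine hwv (Submodule.mem_span_singleton.2 ⟨-(t⁻¹ * s), ?_⟩)
      have h2 : t⁻¹ • (s • v + t • w) = 0 := by rw [h1, smul_zero]
      rw [smul_add, smul_smul, smul_smul, inv_mul_cancel₀ ht, one_smul] at h2
      rw [neg_smul]
      exact neg_eq_of_add_eq_zero_right h2
    subst ht
    rw [zero_smul, add_zero, smul_eq_zero] at h1
    simpa using h1.resolve_right hv0
  refine ⟨LinearMap.linearEquivOfInjective f hf (by simp [hℓ]), ?_⟩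
  simp [f]

theorem linearEquiv_apply_eq {ℓ : Submodule F (Fin 6 → F)} (e : (F × F) ≃ₗ[F] ℓ) (w : F × F)
    (j : Fin 6) : (e w : Fin 6 → F) j =
      w.1 * (e (1, 0) : Fin 6 → F) j + w.2 * (e (0, 1) : Fin 6 → F) j := by
  have h : w = w.1 • ((1, 0) : F × F) + w.2 • ((0, 1) : F × F) := by ext <;> simp
  conv_lhs => rw [h, map_add, map_smul, map_smul]
  simp

/-- A line with a point at which `X₂ = X₅ = 0` has a multiple zero there. -/
theorem ncard_zeros_of_degenerate [Finite F] (hF : 2 < Nat.card F)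
    {ℓ : Submodule F (Fin 6 → F)} (e : (F × F) ≃ₗ[F] ℓ)
    (h1 : (e (1, 0) : Fin 6 → F) 1 = 0) (h4 : (e (1, 0) : Fin 6 → F) 4 = 0) :
    {w | cubicForm 1 (e w : Fin 6 → F) = 0}.ncard ≠ 1 ∧
      {w | cubicForm 1 (e w : Fin 6 → F) = 0}.ncard ≠ 1 + (Nat.card F - 1) * 3 := by
  obtain ⟨A, B, hAB⟩ : ∃ A B : F, ∀ w : F × F, cubicForm 1 (e w : Fin 6 → F) =
      w.2 ^ 2 * (w.1 * A + w.2 * B) := by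
    refine ⟨(e (1, 0) : Fin 6 → F) 0 * (e (0, 1) : Fin 6 → F) 4 ^ 2 +
      (e (1, 0) : Fin 6 → F) 5 * (e (0, 1) : Fin 6 → F) 1 ^ 2,
      (e (0, 1) : Fin 6 → F) 0 * (e (0, 1) : Fin 6 → F) 4 ^ 2 +
      (e (0, 1) : Fin 6 → F) 5 * (e (0, 1) : Fin 6 → F) 1 ^ 2, fun w => ?_⟩
    simp only [cubicForm, linearEquiv_apply_eq e w, h1, h4]
    ring
  simp only [hAB]
  have range_le : ∀ g : F → F × F, (Set.range g).ncard ≤ Nat.card F := fun g => by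
    rw [← Set.image_univ, ← Set.ncard_univ]
    exact Set.ncard_image_le
  constructor
  · intro h
    obtain ⟨a, ha⟩ := Set.ncard_eq_one.1 h
    have e1 : ((1, 0) : F × F) ∈ ({a} : Set (F × F)) := by rw [← ha]; simp
    have e2 : (0 : F × F) ∈ ({a} : Set (F × F)) := by rw [← ha]; simp
    rw [Set.mem_singleton_iff] at e1 e2
    have := congrArg Prod.fst (e1.trans e2.symm)
    simp at this
  · by_cases h0 : A = 0 ∧ B = 0
    -- If the form vanishes on the line, then `q² = 1 + 3(q - 1)`, that is `(q - 1)(q - 2) = 0`,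
    -- contrary to `q > 2`.
    · have : {w : F × F | w.2 ^ 2 * (w.1 * A + w.2 * B) = 0} = Set.univ := by
        ext w; simp [h0.1, h0.2]
      rw [this, Set.ncard_univ, Nat.card_prod]
      intro h
      obtain ⟨m, hm⟩ := Nat.exists_eq_add_of_lt hF
      rw [hm] at h
      have : 2 + m + 1 - 1 = m + 2 := by omega
      rw [this] at h
      nlinarith
    · have hsub : ∃ g : F → F × F,
          {w : F × F | w.2 ^ 2 * (w.1 * A + w.2 * B) = 0} ⊆
            (Set.range fun s : F => (s, (0 : F))) ∪ Set.range g := by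
        by_cases hA : A = 0
        · refine ⟨fun s => (s, 0), fun w hw => Or.inl ⟨w.1, ?_⟩⟩
          have hB : B ≠ 0 := fun hB => h0 ⟨hA, hB⟩
          have : w.2 = 0 := by simpa [hA, hB] using hw
          rw [← this]
        · refine ⟨fun t => (-(t * B) / A, t), fun w hw => ?_⟩
          rcases mul_eq_zero.1 (show w.2 ^ 2 * (w.1 * A + w.2 * B) = 0 from hw) with h | h
          · left
            refine ⟨w.1, ?_⟩
            have : w.2 = 0 := by simpa using h
            rw [← this]
          · right
            refine ⟨w.2, Prod.ext ?_ rfl⟩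
            dsimp only
            rw [div_eq_iff hA]
            linear_combination -h
      obtain ⟨g, hg⟩ := hsub
      -- The zeros lie in two sets of at most `q` vectors each, and `2q < 3q - 2`.
      have h5 := (Set.ncard_le_ncard hg (Set.toFinite _)).trans (Set.ncard_union_le _ _)
      have h6 := range_le fun s : F => (s, (0 : F))
      have h7 := range_le g
      omega

/-- A line of `Q(4, q)` that meets `𝒴` in no point or in three points is the graph of a
unimodular linear map, and the cubic form restricts to a binary cubic. -/
theorem exists_binaryCubic_of_mem_lineClass [Finite F] [CharP F 2] (hF : 2 < Nat.card F) {i : ℕ}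
    (hi : i = 0 ∨ i = 3) {ℓ : Submodule F (Fin 6 → F)} (hℓ : ℓ ∈ lineClass F 1 i) :
    ∃ (e : (F × F) ≃ₗ[F] ℓ) (α β γ δ : F), α * δ + β * γ = 1 ∧
      ∀ w, cubicForm 1 (e w : Fin 6 → F) = binaryCubic α β γ δ w := by
  have h2 : (2 : F) = 0 := CharTwo.two_eq_zero
  obtain ⟨hQ, hY⟩ := hℓ
  -- The projection to `(X₂, X₅)`. A nonzero kernel vector would be a multiple zero, which the
  -- number of points on `𝒴` rules out.
  let π : ℓ →ₗ[F] F × F :=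
    ((LinearMap.proj (R := F) (φ := fun _ : Fin 6 => F) 1).prod
      (LinearMap.proj (R := F) (φ := fun _ : Fin 6 => F) 4)).comp ℓ.subtype
  have hπ : Function.Injective π := by
    rw [injective_iff_map_eq_zero]
    rintro ⟨v, hv⟩ h
    by_contra hne
    have hv0 : v ≠ 0 := fun h0 => hne (Subtype.ext h0)
    obtain ⟨e, he⟩ := exists_linearEquiv_of_finrank_eq_two hQ.1 hv hv0
    have hv14 : v 1 = 0 ∧ v 4 = 0 := by simpa [π] using h
    have hd := ncard_zeros_of_degenerate hF e (by rw [he]; exact hv14.1) (by rw [he]; exact hv14.2)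
    have hc := ncard_zeros_eq e hQ 1
    rw [hY] at hc
    rcases hi with rfl | rfl
    · exact hd.1 (by simpa using hc)
    · exact hd.2 hc
  let e := (LinearMap.linearEquivOfInjective π hπ (by simp [hQ.1])).symm
  have he : ∀ w, (e w : Fin 6 → F) 1 = w.1 ∧ (e w : Fin 6 → F) 4 = w.2 := fun w => by
    have h : π (e w) = w :=
      (LinearMap.linearEquivOfInjective π hπ (by simp [hQ.1])).apply_symm_apply w
    exact ⟨congrArg Prod.fst h, congrArg Prod.snd h⟩
  refine ⟨e, (e (1, 0) : Fin 6 → F) 0, (e (0, 1) : Fin 6 → F) 0, (e (1, 0) : Fin 6 → F) 5,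
    (e (0, 1) : Fin 6 → F) 5, ?_, fun w => ?_⟩
  -- The Klein form vanishes at both basis vectors and at their sum. As `X₃ = X₄`, the term `X₃ X₄`
  -- is a square and has no cross term, so polarization leaves `αδ + βγ + 1 = 0`.
  · have k1 := forms_eq_zero_of_mem_quadricLines hQ (e (1, 0)).2
    have k2 := forms_eq_zero_of_mem_quadricLines hQ (e (0, 1)).2
    have k3 := (forms_eq_zero_of_mem_quadricLines hQ (e (1, 1)).2).1
    have s0 := linearEquiv_apply_eq e (1, 1)
    simp only [kleinForm, s0, (he (1, 0)).1, (he (1, 0)).2, (he (0, 1)).1, (he (0, 1)).2]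
      at k1 k2 k3
    grind
  · simp only [cubicForm, (he w).1, (he w).2, binaryCubic]
    rw [linearEquiv_apply_eq e w 0, linearEquiv_apply_eq e w 5]
    ring

end Lines

end TwistedCubic

namespace TwistedCubic

/-! ### Intersection numbers of the lines with the orbits. -/

section Counting

variable {F : Type*} [Field F] [Finite F] [CharP F 2]

theorem ncard_orbitZ_eq {ω : F} (hω : ω ≠ 0) {ℓ : Submodule F (Fin 6 → F)}
    (hℓ : ℓ ∈ quadricLines F) (e : (F × F) ≃ₗ[F] ℓ) {g : F × F → F}
    (he : ∀ w, cubicForm 1 (e w : Fin 6 → F) = g w) (i : ℕ) :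
    {w | g w ∈ cubeClass ω (2 * (i - 1))}.ncard =
      (Nat.card F - 1) * (pointsOn ℓ ∩ orbitZ 1 ω i).ncard := by
  rw [← ncard_vectors_eq e _ (fun w => g w ∈ cubeClass ω (2 * (i - 1))) fun w hw => by
    rw [← he]
    exact mk_mem_orbitZ_iff hω i hw (forms_eq_zero_of_mem_quadricLines hℓ (e w).2).1
      (forms_eq_zero_of_mem_quadricLines hℓ (e w).2).2]
  congr 1
  ext w
  refine ⟨fun h => ⟨?_, h⟩, fun h => h.2⟩
  rintro rfl
  refine ne_zero_of_mem_cubeClass hω h ?_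
  rw [← he]
  simp [cubicForm]

/-- The intersection numbers of a line of `ℒ₃` or `ℒ₀` with the orbits `𝒵₁, 𝒵₂, 𝒵₃`. -/
theorem ncard_lineClass_inter_orbitZ {ω : Fˣ} (hω : ∀ x : Fˣ, x ∈ Subgroup.zpowers ω)
    (hq : Nat.card F ≡ 1 [MOD 3]) {r : ℤ} (hr : r ^ 2 = Nat.card F) (hr3 : (3 : ℤ) ∣ r - 1)
    (ℓ : Submodule F (Fin 6 → F)) :
    (ℓ ∈ lineClass F 1 3 →
      (3 * (pointsOn ℓ ∩ orbitZ 1 (ω : F) 1).ncard : ℤ) = r ^ 2 - 2 * r - 2 ∧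
      (3 * (pointsOn ℓ ∩ orbitZ 1 (ω : F) 2).ncard : ℤ) = r ^ 2 + r - 2 ∧
      (3 * (pointsOn ℓ ∩ orbitZ 1 (ω : F) 3).ncard : ℤ) = r ^ 2 + r - 2) ∧
    (ℓ ∈ lineClass F 1 0 →
      (3 * (pointsOn ℓ ∩ orbitZ 1 (ω : F) 1).ncard : ℤ) = r ^ 2 - 2 * r + 1 ∧
      (3 * (pointsOn ℓ ∩ orbitZ 1 (ω : F) 2).ncard : ℤ) = r ^ 2 + r + 1 ∧
      (3 * (pointsOn ℓ ∩ orbitZ 1 (ω : F) 3).ncard : ℤ) = r ^ 2 + r + 1) := by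
  have := Fintype.ofFinite F
  have hF1 : 1 < Nat.card F := Finite.one_lt_card
  have hF : 2 < Nat.card F := by
    have : Nat.card F % 3 = 1 := hq
    omega
  have hcast : ((Nat.card F - 1 : ℕ) : ℤ) = (Fintype.card F : ℤ) - 1 := by
    rw [Nat.cast_sub hF1.le, Nat.card_eq_fintype_card, Nat.cast_one]
  have hr' : r ^ 2 = Fintype.card F := by rw [hr, Nat.card_eq_fintype_card]
  have key : ∀ i, i = 0 ∨ i = 3 → ℓ ∈ lineClass F 1 i → ∃ α β γ δ : F, α * δ + β * γ = 1 ∧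
      ({w | binaryCubic α β γ δ w = 0}.ncard : ℤ) = 1 + (Fintype.card F - 1) * i ∧
      ({w | binaryCubic α β γ δ w ∈ cubeClass (ω : F) 0}.ncard : ℤ) =
        (Fintype.card F - 1) * (pointsOn ℓ ∩ orbitZ 1 (ω : F) 1).ncard ∧
      ({w | binaryCubic α β γ δ w ∈ cubeClass (ω : F) 2}.ncard : ℤ) =
        (Fintype.card F - 1) * (pointsOn ℓ ∩ orbitZ 1 (ω : F) 2).ncard ∧
      (pointsOn ℓ ∩ orbitZ 1 (ω : F) 3).ncard = (pointsOn ℓ ∩ orbitZ 1 (ω : F) 2).ncard := by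
    intro i hi hℓ
    obtain ⟨e, α, β, γ, δ, hA, he⟩ := exists_binaryCubic_of_mem_lineClass hF hi hℓ
    have h0 := ncard_zeros_eq e hℓ.1 1
    have h := ncard_orbitZ_eq ω.ne_zero hℓ.1 e he
    have h24 := ncard_cubeClass_two_eq_four (α := α) (β := β) (γ := γ) (δ := δ) ω.ne_zero hA
    simp only [he] at h0
    rw [hℓ.2] at h0
    refine ⟨α, β, γ, δ, hA, ?_, ?_, ?_, ?_⟩
    · rw [h0, ← hcast]; push_cast; ring
    · rw [h 1, ← hcast]; push_cast; ring
    · rw [h 2, ← hcast]; push_cast; ring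
    · have h3 : (Nat.card F - 1) * _ = (Nat.card F - 1) * _ :=
        (h 3).symm.trans (h24.symm.trans (h 2))
      exact Nat.eq_of_mul_eq_mul_left (by omega) h3
  constructor
  · intro hℓ
    obtain ⟨α, β, γ, δ, hA, hT, hN, hN', h32⟩ := key 3 (Or.inr rfl) hℓ
    have h := binaryCubic_count_three hω hq hr' hr3 hA hT hN hN'
    rw [h32]
    exact ⟨h.1, h.2, h.2⟩
  · intro hℓ
    obtain ⟨α, β, γ, δ, hA, hT, hN, hN', h32⟩ := key 0 (Or.inl rfl) hℓ
    have h := binaryCubic_count_zero hω hq hr' hr3 hA (by simpa using hT) hN hN'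
    rw [h32]
    exact ⟨h.1, h.2, h.2⟩

end Counting

/-- The signed square root `(-1)^(n/2) √q` of `q = 2^n ≡ 1 mod 3`. -/
theorem exists_signed_sqrt {n q : ℕ} (hq : q = 2 ^ n) (hmod : q ≡ 1 [MOD 3]) :
    ∃ r : ℤ, r ^ 2 = q ∧ (3 : ℤ) ∣ r - 1 ∧ (-1) ^ (n / 2) * √(q : ℝ) = r := by
  obtain ⟨k, rfl | rfl⟩ := Nat.even_or_odd' n
  -- With `n = 2k` the signed root is `(-2)^k`, and `-2 ≡ 1` modulo 3.
  · refine ⟨(-2) ^ k, ?_, ?_, ?_⟩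
    · rw [hq, ← pow_mul, mul_comm k 2, pow_mul, pow_mul]; norm_num
    · have := sub_dvd_pow_sub_pow (-2 : ℤ) 1 k
      rw [one_pow] at this
      exact (by norm_num : (3 : ℤ) ∣ -2 - 1).trans this
    · have h : (q : ℝ) = (2 ^ k) ^ 2 := by rw [hq]; push_cast; rw [mul_comm 2 k, pow_mul]
      rw [h, Real.sqrt_sq (by positivity), Nat.mul_div_cancel_left _ two_pos, ← mul_pow]
      push_cast
      norm_num
  -- An odd exponent gives `q ≡ 2` modulo 3.
  · exfalso
    rw [hq, pow_succ, pow_mul] at hmod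
    have h1 : (2 ^ 2) ^ k * 2 ≡ 1 ^ k * 2 [MOD 3] :=
      ((show 2 ^ 2 ≡ 1 [MOD 3] by decide).pow k).mul_right 2
    rw [one_pow] at h1
    exact absurd (h1.symm.trans hmod) (by decide)

end TwistedCubic

theorem mainTheorem9 (F : Type*) [Field F] [Finite F] [CharP F 2] (n q : ℕ) (hq : q = 2 ^ n)
    (hcard : Nat.card F = q) (hmod : q ≡ 1 [MOD 3])
    (ω : Fˣ) (hω : ∀ x : Fˣ, x ∈ Subgroup.zpowers ω) :
    (∀ ℓ ∈ TwistedCubic.lineClass F 1 3,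
      (TwistedCubic.pointsOn ℓ ∩ TwistedCubic.hypersurfaceY F 1).ncard = 3 ∧
      ((TwistedCubic.pointsOn ℓ ∩ TwistedCubic.orbitZ 1 (ω : F) 1).ncard : ℝ) =
        ((q : ℝ) - (-1) ^ (n / 2) * 2 * √(q : ℝ) - 2) / 3 ∧
      ((TwistedCubic.pointsOn ℓ ∩ TwistedCubic.orbitZ 1 (ω : F) 2).ncard : ℝ) =
        ((q : ℝ) + (-1) ^ (n / 2) * √(q : ℝ) - 2) / 3 ∧
      ((TwistedCubic.pointsOn ℓ ∩ TwistedCubic.orbitZ 1 (ω : F) 3).ncard : ℝ) =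
        ((q : ℝ) + (-1) ^ (n / 2) * √(q : ℝ) - 2) / 3) ∧
    (∀ ℓ ∈ TwistedCubic.lineClass F 1 0,
      ((TwistedCubic.pointsOn ℓ ∩ TwistedCubic.orbitZ 1 (ω : F) 1).ncard : ℝ) =
        ((q : ℝ) - (-1) ^ (n / 2) * 2 * √(q : ℝ) + 1) / 3 ∧
      ((TwistedCubic.pointsOn ℓ ∩ TwistedCubic.orbitZ 1 (ω : F) 2).ncard : ℝ) =
        ((q : ℝ) + (-1) ^ (n / 2) * √(q : ℝ) + 1) / 3 ∧
      ((TwistedCubic.pointsOn ℓ ∩ TwistedCubic.orbitZ 1 (ω : F) 3).ncard : ℝ) =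
        ((q : ℝ) + (-1) ^ (n / 2) * √(q : ℝ) + 1) / 3) := by

  obtain ⟨r, hr, hr3, hrq⟩ := TwistedCubic.exists_signed_sqrt hq hmod
  have hqr : (q : ℝ) = (r : ℝ) ^ 2 := by exact_mod_cast hr.symm
  have main := TwistedCubic.ncard_lineClass_inter_orbitZ hω (hcard ▸ hmod) (hcard ▸ hr) hr3
  have conv : ∀ {N : ℕ} {x : ℝ} {z : ℤ}, (3 * N : ℤ) = z → 3 * x = z → (N : ℝ) = x := by
    intro N x z h1 h2
    have h3 : (3 * N : ℝ) = z := by exact_mod_cast h1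
    linarith
  refine ⟨fun ℓ hℓ => ?_, fun ℓ hℓ => ?_⟩
  · obtain ⟨h1, h2, h3⟩ := (main ℓ).1 hℓ
    refine ⟨hℓ.2, conv h1 ?_, conv h2 ?_, conv h3 ?_⟩ <;> push_cast
    · linear_combination hqr - 2 * hrq
    · linear_combination hqr + hrq
    · linear_combination hqr + hrq
  · obtain ⟨h1, h2, h3⟩ := (main ℓ).2 hℓ
    refine ⟨conv h1 ?_, conv h2 ?_, conv h3 ?_⟩ <;> push_cast
    · linear_combination hqr - 2 * hrq
    · linear_combination hqr + hrq
    · linear_combination hqr + hrq
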